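/- **Setting.** Let $d\ge 1$, write $\Lambda_L(x)=x+(-\frac L2,\frac L2)^d$, and let $u\colon\mathbb R^d\to\mathbb R$ be measurable with $u_-\chi_{\Lambda_{\delta_-}(0)}\le u\le u_+\chi_{\Lambda_{\delta_+}(0)}$ (almost everywhere) for constants $u_\pm,\delta_\pm\in(0,\infty)$. Let $(\mathbf Y,\varepsilon_{\mathbf Y})$ be a marked Poisson process of density $2\varrho$ on $\mathbb R^d\times\{0,1\}$, i.e. a Poisson process there with intensity $2\varrho|\tilde A|$, $|\tilde A|=\frac12\big(|\{x:(x,0)\in \tilde A\}|+|\{x:(x,1)\in \tilde A\}|\big)$, of the form $\{(\zeta,\varepsilon_\zeta):\zeta\in\mathbf Y\}$, defined on a probability space $(\Omega,\mathbb P)$; let $\mathbf X$ (resp. $\mathbf X'$) be the set of points of $\mathbf Y$ with mark $1$ (resp. $0$), so $\mathbf X$ is a Poisson process of density $\varrho$ and $H_{\mathbf X}=-\Delta+\sum_{\zeta\in\mathbf X}u(\cdot-\zeta)$ is the Poisson Hamiltonian. For a set $X$ let $N_X(A)=\#(X\cap A)$. For a box $\Lambda$, disjoint finite sets $X,Y$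 and $t\in[0,1]^Y$ let $H_{X,(Y,t),\Lambda}=-\Delta_\Lambda+\sum_{\zeta\in X\cap\Lambda}u(\cdot-\zeta)+\sum_{\zeta\in Y\cap\Lambda}t_\zeta u(\cdot-\zeta)$ on $L^2(\Lambda)$ with Dirichlet boundary condition, let $R_t(E)=(H_{X,(Y,t),\Lambda}-E)^{-1}$, and let $\chi_y$ be the characteristic function of $\Lambda_1(y)$. Fix exponents $\kappa\in(0,1)$, $\sigma>0$, $\tau$ with $d\sigma<\tau<d$, and $\theta>0$ (these are the small quantities in $L^{1-}$, $\Lambda_{L^{1-}}$, $L^{d-}$ and $L^{-(0+)}$). * A box $\Lambda=\Lambda_L(x)$ is $(X,Y,E,m)$-good if $X\cap Y=\emptyset$ and, for all $t\in[0,1]^Y$, $E$ is in the resolvent set of $H_{X,(Y,t),\Lambda}$, $\|R_t(E)\|\le e^{L^{1-\kappa}}$, and $\|\chi_yR_t(E)\chi_z\|\le e^{-m|y-z|}$ for all $y,z\in\Lambda$ with $|y-z|\ge L/10$. * Let $\eta_L=e^{-L^{10^6d}}$ and $\mathbb J_\Lambda=\{j\in x+\eta_L\mathbb Z^d:\Lambda_{\eta_L}(j)\subset\Lambda\}$.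 A countable $X\subset\mathbb R^d$ is $\Lambda$-acceptable if $N_X(\Lambda)<16\varrho L^d$, $N_X(\Lambda_{\eta_L}(j))\le1$ for all $j\in\mathbb J_\Lambda$, and $X$ has no point in $\Lambda\setminus\bigcup_{j\in\mathbb J_\Lambda}\Lambda_{\eta_L(1-\eta_L)}(j)$. Let $[X]_\Lambda$ be the set of all $\Lambda$-acceptable $Z$ with $N_Z(\Lambda_{\eta_L}(j))=N_X(\Lambda_{\eta_L}(j))$ for all $j\in\mathbb J_\Lambda$. * For pairwise disjoint $B,B',S\subset\mathbb J_\Lambda$ with $\#(B\sqcup B'\sqcup S)<16\varrho L^d$, put $C_{\Lambda,B,S}=\bigcup_{S'\subset S}[B\cup S']_\Lambda$ and define the basic event $\mathcal C_{\Lambda,B,B',S}=\{\mathbf Y\in[B\sqcup B'\sqcup S]_\Lambda\}\cap\{\mathbf X\in C_{\Lambda,B,S}\}\cap\{\mathbf X'\in C_{\Lambda,B',S}\}$. It is $(\Lambda,E,m)$-adapted if $\Lambda$ is $(B,S,E,m)$-good and, with $\ell=L^{1-\sigma}$, $\#(S\cap\Lambda_{\ell-\delta_+}(z))\ge L^{d-\tau}$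 for every box $\Lambda_\ell(z)\subset\Lambda$. * For $p>0$, the scale $L$ is $(E,m)$-localizing if for every box $\Lambda$ of side $L$ there is an event $\Omega_\Lambda$, a finite disjoint union of $(\Lambda,E,m)$-adapted basic events, with $\mathbb P\{\Omega_\Lambda\}>1-L^{-p}$. **Proposition.** Let $p>0$ and $E_0>0$. There is a constant $C=C_{d,u,p,E_0}>0$ and, for all exponents $\kappa,\sigma,\tau,\theta$ as above, a scale $\overline L_0<\infty$, depending only on $d,u,E_0,p$ and these exponents, such that, if $L\ge\overline L_0$ and $\varrho>0$ satisfy $\varrho\ge C\log L$ and $L^{-\theta}\le\varrho\le e^{L^d}$, then the scale $L$ is $(E,\tfrac12\sqrt{E_0})$-localizing for all energies $E\in[0,E_0]$. -/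

import Mathlib

open MeasureTheory ProbabilityTheory Filter Topology Set
open scoped ENNReal

noncomputable section

namespace PoissonLoc

/-- `ℝ^d` with its Euclidean norm and Lebesgue measure `volume`. -/
abbrev Space (d : ℕ) : Type := EuclideanSpace ℝ (Fin d)

/-! ### Boxes -/

/-- The open box `Λ_L(x) = x + (-L/2, L/2)^d` of side `L` centred at `x`. -/
def box {d : ℕ} (L : ℝ) (x : Space d) : Set (Space d) :=
  {y | ∀ i, |y i - x i| < L / 2}

theorem isOpen_box {d : ℕ} (L : ℝ) (x : Space d) : IsOpen (box L x) := by
  have h : box L x = ⋂ i, {y : Space d | |y i - x i| < L / 2} := by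
    ext y; simp [box]
  rw [h]
  exact isOpen_iInter_of_finite fun i => isOpen_lt (by fun_prop) continuous_const

/-! ### Poisson processes -/

/-- `Z` is a Poisson process on `S`, defined on the probability space `(Ω, P)`, with intensity
measure `μ`: a random countable set whose numbers of points `N_Z(A) = #(Z ∩ A)` are random
variables, Poisson distributed with mean `μ A` when `μ A < ∞`, and independent for disjoint
measurable sets. -/
structure IsPoissonProcess {Ω S : Type*} [MeasurableSpace Ω] [MeasurableSpace S]
    (P : Measure Ω) (μ : Measure S) (Z : Ω → Set S) : Prop where
  countable : ∀ ω, (Z ω).Countable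
  measurable : ∀ A : Set S, MeasurableSet A → Measurable fun ω => (Z ω ∩ A).encard
  law : ∀ A : Set S, MeasurableSet A → μ A < ∞ → ∀ k : ℕ,
    P {ω | (Z ω ∩ A).encard = k} =
      ENNReal.ofReal ((μ A).toReal ^ k / (k.factorial : ℝ) * Real.exp (-(μ A).toReal))
  indep : ∀ (n : ℕ) (A : Fin n → Set S), (∀ j, MeasurableSet (A j)) →
    (Pairwise fun i j => Disjoint (A i) (A j)) →
    iIndepFun (fun j ω => (Z ω ∩ A j).encard) P

/-- The measure `|A| = (|{x ; (x,0) ∈ A}| + |{x ; (x,1) ∈ A}|) / 2` on `ℝ^d × {0,1}`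
(marks in `Bool`, with `false` for `0` and `true` for `1`). -/
def markedVolume (d : ℕ) : Measure (Space d × Bool) :=
  (2 : ℝ≥0∞)⁻¹ • ((volume : Measure (Space d)).map (fun x => (x, false)) +
    (volume : Measure (Space d)).map (fun x => (x, true)))

/-- The marked configuration `{(ζ, ε_ζ) ; ζ ∈ Y}`; the values of `ε` off `Y` play no role. -/
def markedConfig {d : ℕ} (Y : Set (Space d)) (ε : Space d → Bool) : Set (Space d × Bool) :=
  {q | q.1 ∈ Y ∧ q.2 = ε q.1}

/-- `(Y, ε_Y)` is the marked Poisson process of density `2ϱ` on `ℝ^d × {0,1}`; thus `Y` is a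
Poisson process of density `2ϱ` whose points carry independent fair Bernoulli marks. -/
def IsMarkedPoisson {d : ℕ} {Ω : Type*} [MeasurableSpace Ω] (P : Measure Ω) (ϱ : ℝ)
    (Y : Ω → Set (Space d)) (ε : Ω → Space d → Bool) : Prop :=
  IsPoissonProcess P (ENNReal.ofReal (2 * ϱ) • markedVolume d)
    (fun ω => markedConfig (Y ω) (ε ω))

/-- The points of `Y` with mark `b`: for `b = true` this is the Poisson process `X` of density
`ϱ` that carries the impurities, for `b = false` the complementary process `X'`. -/
def marked {d : ℕ} {Ω : Type*} (Y : Ω → Set (Space d)) (ε : Ω → Space d → Bool) (b : Bool)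
    (ω : Ω) : Set (Space d) :=
  {ζ | ζ ∈ Y ω ∧ ε ω ζ = b}

/-! ### Finite volume operators -/

/-- The Hilbert space `L²(Λ)`. -/
abbrev L2 {d : ℕ} (Λ : Set (Space d)) : Type := Lp ℂ 2 ((volume : Measure (Space d)).restrict Λ)

/-- `φ ∈ C_c^∞(Λ)`. -/
def IsTest {d : ℕ} (Λ : Set (Space d)) (φ : Space d → ℂ) : Prop :=
  ContDiff ℝ ((⊤ : ℕ∞) : WithTop ℕ∞) φ ∧ HasCompactSupport φ ∧ tsupport φ ⊆ Λ

/-- The partial derivative `∂_i φ`. -/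
def pderiv {d : ℕ} (i : Fin d) (φ : Space d → ℂ) (y : Space d) : ℂ :=
  fderiv ℝ φ y (EuclideanSpace.single i 1)

/-- `v` lies in `H^1_0(Λ)`, the domain of the gradient `∇_Λ` with Dirichlet boundary condition,
and `∇_Λ v = G`: the pair `(v, G)` belongs to the closure in `L²` of the graph of the gradient on
`C_c^∞(Λ)`. -/
def HasDirichletGradient {d : ℕ} {Λ : Set (Space d)} (v : L2 Λ) (G : Fin d → L2 Λ) : Prop :=
  ∃ φ : ℕ → Space d → ℂ, (∀ n, IsTest Λ (φ n)) ∧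
    Tendsto (fun n => eLpNorm (fun y => φ n y - v y) 2 (volume.restrict Λ)) atTop (𝓝 0) ∧
    ∀ i, Tendsto (fun n => eLpNorm (fun y => pderiv i (φ n) y - G i y) 2 (volume.restrict Λ)) atTop (𝓝 0)

/-- The graph of the self-adjoint operator `H = -Δ_Λ + V` on `L²(Λ)` with Dirichlet boundary
condition, for a bounded potential `V` on `Λ`: `Hamiltonian V v g` says that `v` is in the domain
of `H` and `H v = g`, that is, `v ∈ H^1_0(Λ)` and `-Δ v + V v = g` weakly in `Λ`. -/
def Hamiltonian {d : ℕ} {Λ : Set (Space d)} (V : Space d → ℝ) (v g : L2 Λ) : Prop :=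
  ∃ G : Fin d → L2 Λ, HasDirichletGradient v G ∧
    ∀ φ : Space d → ℂ, IsTest Λ φ →
      (∑ i, ∫ y in Λ, pderiv i φ y * G i y) + ∫ y in Λ, φ y * ((V y : ℂ) * v y)
        = ∫ y in Λ, φ y * g y

/-- `E` is in the resolvent set of `H = -Δ_Λ + V` and `R = (H - E)⁻¹`. -/
def IsResolvent {d : ℕ} {Λ : Set (Space d)} (V : Space d → ℝ) (E : ℝ)
    (R : L2 Λ →L[ℂ] L2 Λ) : Prop :=
  (∀ f : L2 Λ, Hamiltonian V (R f) (f + (E : ℂ) • R f)) ∧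
    ∀ v g : L2 Λ, Hamiltonian V v g → R (g - (E : ℂ) • v) = v

/-- Multiplication by the characteristic function of `A`, as a linear map on `L²(μ)`. -/
def cutoffLin {α : Type*} [MeasurableSpace α] {μ : Measure α} (A : Set α)
    (hA : MeasurableSet A) : Lp ℂ 2 μ →ₗ[ℂ] Lp ℂ 2 μ where
  toFun f := ((Lp.memLp f).indicator hA).toLp (A.indicator (f : α → ℂ))
  map_add' := by
    intro f g
    rw [← MemLp.toLp_add, MemLp.toLp_eq_toLp_iff]
    filter_upwards [Lp.coeFn_add f g] with y hy
    by_cases h : y ∈ A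
    · simpa [h] using hy
    · simp [h]
  map_smul' := by
    intro c f
    rw [RingHom.id_apply, ← MemLp.toLp_const_smul, MemLp.toLp_eq_toLp_iff]
    filter_upwards [Lp.coeFn_smul c f] with y hy
    by_cases h : y ∈ A
    · simpa [h] using hy
    · simp [h]

theorem cutoffLin_apply {α : Type*} [MeasurableSpace α] {μ : Measure α} (A : Set α)
    (hA : MeasurableSet A) (f : Lp ℂ 2 μ) :
    cutoffLin A hA f = ((Lp.memLp f).indicator hA).toLp (A.indicator (f : α → ℂ)) :=
  rfl

theorem coeFn_cutoffLin {α : Type*} [MeasurableSpace α] {μ : Measure α} (A : Set α)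
    (hA : MeasurableSet A) (f : Lp ℂ 2 μ) :
    (cutoffLin A hA f : α → ℂ) =ᵐ[μ] A.indicator (f : α → ℂ) := by
  rw [cutoffLin_apply]
  exact MemLp.coeFn_toLp _

theorem norm_cutoffLin_le {α : Type*} [MeasurableSpace α] {μ : Measure α} (A : Set α)
    (hA : MeasurableSet A) (f : Lp ℂ 2 μ) : ‖cutoffLin A hA f‖ ≤ 1 * ‖f‖ := by
  rw [one_mul]
  refine Lp.norm_le_norm_of_ae_le ?_
  filter_upwards [coeFn_cutoffLin A hA f] with y hy
  rw [hy]
  exact norm_indicator_le_norm_self _ _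

/-- Multiplication by the characteristic function of `A`, as an operator on `L²(μ)`. -/
def cutoff {α : Type*} [MeasurableSpace α] {μ : Measure α} (A : Set α)
    (hA : MeasurableSet A) : Lp ℂ 2 μ →L[ℂ] Lp ℂ 2 μ :=
  (cutoffLin A hA).mkContinuous 1 (norm_cutoffLin_le A hA)

/-- `χ_x`, the characteristic function of the unit box centred at `x`, as an operator on
`L²(Λ)`. -/
def chi {d : ℕ} {Λ : Set (Space d)} (x : Space d) : L2 Λ →L[ℂ] L2 Λ :=
  cutoff (box 1 x) (isOpen_box 1 x).measurableSet

/-- The potential `V_{X,(Y,t),Λ}`, as a function on `Λ`: the impurities in `X ∩ Λ` with full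
strength and the impurities `ζ ∈ Y ∩ Λ` with strength `t ζ`. -/
def potential {d : ℕ} (u : Space d → ℝ) (Λ : Set (Space d)) (X Y : Finset (Space d))
    (t : Space d → ℝ) (y : Space d) : ℝ :=
  (∑ ζ ∈ X, Λ.indicator (fun ζ => u (y - ζ)) ζ) +
    ∑ ζ ∈ Y, Λ.indicator (fun ζ => t ζ * u (y - ζ)) ζ

/-! ### Good boxes

The small exponents, fixed independently of the scale: `L^{1-}` in the resolvent bound is
`L^(1-κ)`, the side `L^{1-}` of the boxes in the density condition is `L^(1-σ)`, and the number
`L^{d-}` of free sites there is `L^(d-τ)`. -/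

/-- The box `Λ_L(x)` is `(X, Y, E, m)`-good, for finite configurations `X` and `Y`: `X` and `Y` are
disjoint, and for all `t ∈ [0,1]^Y` the resolvent at `E` of the Hamiltonian with potential
`V_{X,(Y,t),Λ}` exists, has norm at most `exp (L^(1-κ))`, and decays at rate `m`. -/
def IsGoodBox {d : ℕ} (u : Space d → ℝ) (κ : ℝ) (L : ℝ) (x : Space d) (E m : ℝ)
    (X Y : Finset (Space d)) : Prop :=
  Disjoint X Y ∧
    ∀ t : Space d → ℝ, (∀ ζ ∈ Y, t ζ ∈ Icc (0 : ℝ) 1) →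
      ∃ R : L2 (box L x) →L[ℂ] L2 (box L x),
        IsResolvent (potential u (box L x) X Y t) E R ∧
        ‖R‖ ≤ Real.exp (L ^ (1 - κ)) ∧
        ∀ y ∈ box L x, ∀ z ∈ box L x, L / 10 ≤ ‖y - z‖ →
          ‖(chi y).comp (R.comp (chi z))‖ ≤ Real.exp (-m * ‖y - z‖)

/-- The density condition on the free sites `S`: every box of side `ℓ = L^(1-σ)` inside `Λ_L(x)`
has at least `L^(d-τ)` of them in the concentric box of side `ℓ - δ₊`. -/
def IsDense {d : ℕ} (δp σ τ : ℝ) (L : ℝ) (x : Space d) (S : Finset (Space d)) : Prop :=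
  ∀ z : Space d, box (L ^ (1 - σ)) z ⊆ box L x →
    L ^ ((d : ℝ) - τ) ≤ (((S : Set (Space d)) ∩ box (L ^ (1 - σ) - δp) z).ncard : ℝ)

/-! ### Acceptable configurations and basic events -/

/-- `η_L = exp (-L^(10^6 d))`. -/
def eta (d : ℕ) (L : ℝ) : ℝ := Real.exp (-(L ^ (10 ^ 6 * d)))

/-- The set of sites `j ∈ x + η_L ℤ^d` with `Λ_{η_L}(j) ⊆ Λ_L(x)`. -/
def sites {d : ℕ} (L : ℝ) (x : Space d) : Set (Space d) :=
  {j | (∃ k : Fin d → ℤ, ∀ i, j i = x i + eta d L * k i) ∧ box (eta d L) j ⊆ box L x}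

/-- The configuration `X` is `Λ_L(x)`-acceptable. -/
def IsAcceptable {d : ℕ} (ϱ L : ℝ) (x : Space d) (X : Set (Space d)) : Prop :=
  X.Countable ∧
  ((X ∩ box L x).Finite ∧ ((X ∩ box L x).ncard : ℝ) < 16 * ϱ * L ^ d) ∧
  (∀ j ∈ sites L x, (X ∩ box (eta d L) j).encard ≤ 1) ∧
  X ∩ (box L x \ ⋃ j ∈ sites L x, box (eta d L * (1 - eta d L)) j) = ∅

/-- The equivalence class `[X]_Λ` in the set of `Λ`-acceptable configurations, for `Λ = Λ_L(x)`:
same number of points in each box `Λ_{η_L}(j)`. -/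
def cls {d : ℕ} (ϱ L : ℝ) (x : Space d) (X : Set (Space d)) : Set (Set (Space d)) :=
  {Z | IsAcceptable ϱ L x Z ∧
    ∀ j ∈ sites L x, (Z ∩ box (eta d L) j).encard = (X ∩ box (eta d L) j).encard}

/-- The collection of `J ⊆ sites L x` with `#J < 16 ϱ L^d`. -/
def siteConfigs {d : ℕ} (ϱ L : ℝ) (x : Space d) : Set (Set (Space d)) :=
  {J | J ⊆ sites L x ∧ J.Finite ∧ (J.ncard : ℝ) < 16 * ϱ * L ^ d}

/-- The basic configuration set `C_{Λ,B,S}`, the union of the classes `[B ∪ S']_Λ` over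
`S' ⊆ S`. -/
def bconfset {d : ℕ} (ϱ L : ℝ) (x : Space d) (B S : Finset (Space d)) : Set (Set (Space d)) :=
  {Z | ∃ S' : Set (Space d), S' ⊆ S ∧ Z ∈ cls ϱ L x (B ∪ S')}

/-- The basic event `C_{Λ,B,B',S}`: `Y ∈ [B ∪ B' ∪ S]_Λ`, `X ∈ C_{Λ,B,S}` and
`X' ∈ C_{Λ,B',S}`. -/
def bevent {d : ℕ} {Ω : Type*} (ϱ : ℝ) (Y : Ω → Set (Space d)) (ε : Ω → Space d → Bool)
    (L : ℝ) (x : Space d) (B B' S : Finset (Space d)) : Set Ω :=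
  {ω | Y ω ∈ cls ϱ L x (B ∪ B' ∪ S) ∧ marked Y ε true ω ∈ bconfset ϱ L x B S ∧
    marked Y ε false ω ∈ bconfset ϱ L x B' S}

/-- The triple `B, B', S` defines a `(Λ,E,m)`-adapted basic event, `Λ = Λ_L(x)`: the three sets
are pairwise disjoint with union in `siteConfigs ϱ L x`, the free sites `S` are dense, and the box
is `(B,S,E,m)`-good. -/
def IsAdapted {d : ℕ} (u : Space d → ℝ) (δp κ σ τ : ℝ) (ϱ L : ℝ) (x : Space d) (E m : ℝ)
    (B B' S : Finset (Space d)) : Prop :=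
  (Disjoint B B' ∧ Disjoint B S ∧ Disjoint B' S) ∧
  ((B : Set (Space d)) ∪ B' ∪ S) ∈ siteConfigs ϱ L x ∧
  IsDense δp σ τ L x S ∧
  IsGoodBox u κ L x E m B S

/-- `W` is a `(Λ,E,m)`-localized event, `Λ = Λ_L(x)`: a finite disjoint union of `(Λ,E,m)`-adapted
basic events. -/
def IsLocalizedEvent {d : ℕ} {Ω : Type*} (u : Space d → ℝ) (δp κ σ τ : ℝ) (ϱ : ℝ)
    (Y : Ω → Set (Space d)) (ε : Ω → Space d → Bool) (L : ℝ) (x : Space d) (E m : ℝ)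
    (W : Set Ω) : Prop :=
  ∃ (I : ℕ) (B B' S : Fin I → Finset (Space d)),
    (∀ i, IsAdapted u δp κ σ τ ϱ L x E m (B i) (B' i) (S i)) ∧
    (Pairwise fun i j => Disjoint (bevent ϱ Y ε L x (B i) (B' i) (S i))
      (bevent ϱ Y ε L x (B j) (B' j) (S j))) ∧
    W = ⋃ i, bevent ϱ Y ε L x (B i) (B' i) (S i)

/-- The scale `L` is `(E,m)`-localizing (with probability exponent `p`): every box of side `L`
has a localized event of probability greater than `1 - L^(-p)`. -/
def IsLocalizing {d : ℕ} {Ω : Type*} [MeasurableSpace Ω] (P : Measure Ω) (u : Space d → ℝ)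
    (δp κ σ τ : ℝ) (ϱ : ℝ) (Y : Ω → Set (Space d)) (ε : Ω → Space d → Bool) (p E m L : ℝ) :
    Prop :=
  ∀ x : Space d, ∃ W : Set Ω,
    IsLocalizedEvent u δp κ σ τ ϱ Y ε L x E m W ∧ 1 - L ^ (-p) < P.real W

end PoissonLoc

end

open PoissonLoc

/-!
At density `ϱ ≥ C log L` the impurities are so numerous that, with probability `1 - o(L^(-p))`, they
alone push the spectrum of the finite volume operator above `2 E₀`; every energy in `[0, E₀]` then
lies well below the spectrum, and localization is exponential decay of the resolvent off the
spectrum.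

*Analysis.* If `V ≥ 2 E₀ + 1` on `Λ`, the form of `-Δ_Λ + V - E` is coercive on `H^1_0(Λ)` with
constant one, so its resolvent exists and has norm at most one (`exists_isResolvent`). The domain
`H^1_0(Λ)` is realized as the closed subspace `dirichletGraph` of pairs `(v, ∇v)`. For the decay, the
equation is tested with `ψ² v`, where `ψ = exp (m ⟪e, ·⟫)` is an exponential of a linear function in
the direction `e` of `y - z`; being smooth, it preserves `H^1_0(Λ)`, and the gradient terms cost
only `m² ‖ψ v‖²` (`norm_mulOp_expWeight_le`). With `m = √E₀` this gives decay
`exp (-√E₀ (|y - z| - d))` between unit boxes (`norm_chi_comp_chi_le`), hence rate `√E₀ / 2` at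
distance `L / 10`.

*Free sites.* Tile space by cells of side `a = δm / 8`, and call a site free if it lies in the
lower half of its cell in the first coordinate. Given the configuration, let `S` be the occupied
free sites, and `B` and `B'` the other sites occupied by points of mark `1` and `0`. The triple
`(B, B', S)` can be read off from the configuration, so the basic events are disjoint
(`exists_isLocalizedEvent`). If each half of each cell contains `N` impurities with
`N u₋ ≥ 2 E₀ + 1`, the impurities in `B` make the potential large everywhere whatever the coupling
constants on `S` are, and `S` has `≥ c ℓ^d = c L^((1-σ)d)` sites in boxes of side `ℓ - δ₊`, which
beats `L^(d-τ)` since `d σ < τ` (`isAdapted_of_dense`).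

*Probability.* Only the one-box Poisson law and union bounds are needed: a half cell has fewer than
`N` impurities with probability at most `2^N exp (-c ϱ)`, a negative power of `L` as large as desired
by the choice of `C`; the box has too many points with probability at most `exp (-12 ϱ L^d)`; the
remaining acceptability conditions fail with probability at most a multiple of the tiny `η_L` times
`exp (4 L^d)` (`real_not_isGoodConfig_le`, `bad_bound_lt`).
-/

open MeasureTheory ProbabilityTheory Filter Topology Set
open scoped ENNReal

noncomputable section

namespace PoissonLoc

/-! ### Coercive problems on a closed subspace -/

open scoped InnerProductSpace in
/-- Lax–Milgram on a complete subspace `D`: if `A` is coercive on `D`, there is a bounded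
solution operator for the variational problem `⟪q, A w⟫ = ⟪q, f⟫` for all `q ∈ D`. -/
theorem exists_solution_operator {F : Type*} [NormedAddCommGroup F] [InnerProductSpace ℂ F]
    [CompleteSpace F] (D : Submodule ℂ F) [CompleteSpace D] (A : F →L[ℂ] F)
    (hA : ∀ w ∈ D, ‖w‖ ^ 2 ≤ (⟪w, A w⟫_ℂ).re) :
    ∃ Sol : F →L[ℂ] D, (∀ f, ∀ q ∈ D, ⟪q, A (Sol f)⟫_ℂ = ⟪q, f⟫_ℂ) ∧
      ∀ (w : F) (f : F), w ∈ D → (∀ q ∈ D, ⟪q, A w⟫_ℂ = ⟪q, f⟫_ℂ) → (Sol f : F) = w := by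
  let T : D →L[ℂ] D := (ContinuousLinearMap.adjoint D.subtypeL).comp (A.comp D.subtypeL)
  have hT : ∀ q w : D, ⟪q, T w⟫_ℂ = ⟪(q : F), A w⟫_ℂ := by
    intro q w
    simp only [T, ContinuousLinearMap.comp_apply, ContinuousLinearMap.adjoint_inner_right]
    rfl
  have hP : ∀ (q : D) (f : F),
      ⟪q, ContinuousLinearMap.adjoint D.subtypeL f⟫_ℂ = ⟪(q : F), f⟫_ℂ := by
    intro q f
    rw [ContinuousLinearMap.adjoint_inner_right]
    rfl
  have hunit : IsUnit T := by
    refine ContinuousLinearMap.isUnit_of_forall_le_norm_inner_map T (c := 1) one_pos ?_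
    intro w
    have h1 := hA w w.2
    rw [← hT] at h1
    rw [norm_inner_symm]
    simpa using h1.trans (Complex.re_le_norm _)
  obtain ⟨U, hU⟩ := hunit
  refine ⟨(U⁻¹ : (D →L[ℂ] D)ˣ).val.comp (ContinuousLinearMap.adjoint D.subtypeL), ?_, ?_⟩
  · intro f q hq
    have h1 := hT ⟨q, hq⟩ ((U⁻¹ : (D →L[ℂ] D)ˣ).val (ContinuousLinearMap.adjoint D.subtypeL f))
    rw [ContinuousLinearMap.comp_apply]
    rw [← h1, ← hU, ← mul_apply_eq_comp, U.mul_inv, one_apply_eq_self]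
    exact hP ⟨q, hq⟩ f
  · intro w f hw h
    have h1 : T ⟨w, hw⟩ = ContinuousLinearMap.adjoint D.subtypeL f := by
      refine ext_inner_left ℂ fun q => ?_
      rw [hT, hP]
      exact h q q.2
    rw [ContinuousLinearMap.comp_apply, ← h1, ← hU, ← mul_apply_eq_comp, U.inv_mul,
      one_apply_eq_self]

/-! ### Multiplication operators -/

section Multiplication

variable {α : Type*} [MeasurableSpace α] {μ : Measure α}

/-- `a` is an essentially bounded real function. -/
def EssBounded (μ : Measure α) (a : α → ℝ) : Prop :=
  AEStronglyMeasurable a μ ∧ ∃ c : ℝ, ∀ᵐ y ∂μ, |a y| ≤ c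

theorem EssBounded.memLp_mul {a : α → ℝ} (ha : EssBounded μ a) (f : Lp ℂ 2 μ) :
    MemLp (fun y => (a y : ℂ) * f y) 2 μ := by
  obtain ⟨h1, c, hc⟩ := ha
  refine MemLp.of_le_mul (c := c) (Lp.memLp f)
    ((Complex.continuous_ofReal.comp_aestronglyMeasurable h1).mul (Lp.aestronglyMeasurable f)) ?_
  filter_upwards [hc] with y hy
  rw [norm_mul, Complex.norm_real, Real.norm_eq_abs]
  gcongr

/-- Multiplication by an essentially bounded real function `a`, as an operator on `L²(μ)`. -/
def mulOp (a : α → ℝ) (ha : EssBounded μ a) : Lp ℂ 2 μ →L[ℂ] Lp ℂ 2 μ :=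
  LinearMap.mkContinuousOfExistsBound
    { toFun := fun f => (ha.memLp_mul f).toLp _
      map_add' := by
        intro f g
        rw [← MemLp.toLp_add, MemLp.toLp_eq_toLp_iff]
        filter_upwards [Lp.coeFn_add f g] with y hy
        simp only [hy, Pi.add_apply, mul_add]
      map_smul' := by
        intro c f
        rw [RingHom.id_apply, ← MemLp.toLp_const_smul, MemLp.toLp_eq_toLp_iff]
        filter_upwards [Lp.coeFn_smul c f] with y hy
        simp [hy, mul_left_comm] }
    (by
      obtain ⟨-, c, hc⟩ := id ha
      refine ⟨c, fun f => Lp.norm_le_mul_norm_of_ae_le_mul ?_⟩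
      filter_upwards [hc, (ha.memLp_mul f).coeFn_toLp] with y hy hy2
      simp only [LinearMap.coe_mk, AddHom.coe_mk]
      rw [hy2, norm_mul, Complex.norm_real, Real.norm_eq_abs]
      gcongr)

theorem coeFn_mulOp (a : α → ℝ) (ha : EssBounded μ a) (f : Lp ℂ 2 μ) :
    (mulOp a ha f : α → ℂ) =ᵐ[μ] fun y => (a y : ℂ) * f y :=
  (ha.memLp_mul f).coeFn_toLp

open scoped InnerProductSpace

theorem inner_mulOp_left (a : α → ℝ) (ha : EssBounded μ a) (f g : Lp ℂ 2 μ) :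
    ⟪mulOp a ha f, g⟫_ℂ = ⟪f, mulOp a ha g⟫_ℂ := by
  rw [L2.inner_def, L2.inner_def]
  refine integral_congr_ae ?_
  filter_upwards [coeFn_mulOp a ha f, coeFn_mulOp a ha g] with y h1 h2
  rw [h1, h2]
  simp only [RCLike.inner_apply, map_mul, Complex.conj_ofReal]
  ring

theorem mulOp_mulOp (a b ab : α → ℝ) (ha : EssBounded μ a) (hb : EssBounded μ b)
    (hab : EssBounded μ ab) (h : ∀ y, a y * b y = ab y) (f : Lp ℂ 2 μ) :
    mulOp a ha (mulOp b hb f) = mulOp ab hab f := by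
  refine Lp.ext ?_
  filter_upwards [coeFn_mulOp a ha (mulOp b hb f), coeFn_mulOp b hb f, coeFn_mulOp ab hab f]
    with y h1 h2 h3
  rw [h1, h2, h3, ← h y]
  push_cast
  ring

theorem mulOp_comm (a b : α → ℝ) (ha : EssBounded μ a) (hb : EssBounded μ b) (f : Lp ℂ 2 μ) :
    mulOp a ha (mulOp b hb f) = mulOp b hb (mulOp a ha f) := by
  refine Lp.ext ?_
  filter_upwards [coeFn_mulOp a ha (mulOp b hb f), coeFn_mulOp b hb f, coeFn_mulOp a ha f,
    coeFn_mulOp b hb (mulOp a ha f)] with y h1 h2 h3 h4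
  rw [h1, h2, h4, h3]
  ring

/-- A multiplication operator by a function `≥ c` is bounded below by `c` as a form. -/
theorem le_re_inner_mulOp (a : α → ℝ) (ha : EssBounded μ a) (c : ℝ) (hc : ∀ᵐ y ∂μ, c ≤ a y)
    (f : Lp ℂ 2 μ) : c * ‖f‖ ^ 2 ≤ (⟪f, mulOp a ha f⟫_ℂ).re := by
  have h0 : ‖f‖ ^ 2 = (⟪f, f⟫_ℂ).re := (inner_self_eq_norm_sq (𝕜 := ℂ) f).symm
  have h1 : (c : ℂ) * ⟪f, f⟫_ℂ = ⟪f, (c : ℂ) • f⟫_ℂ := by rw [inner_smul_right]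
  have h2 : c * ‖f‖ ^ 2 = (⟪f, (c : ℂ) • f⟫_ℂ).re := by
    rw [h0, ← h1, Complex.re_ofReal_mul]
  rw [h2, L2.inner_def, L2.inner_def]
  have e1 := L2.integrable_inner (𝕜 := ℂ) f ((c : ℂ) • f)
  have e2 := L2.integrable_inner (𝕜 := ℂ) f (mulOp a ha f)
  have r1 : (∫ y, ⟪f y, ((c : ℂ) • f : Lp ℂ 2 μ) y⟫_ℂ ∂μ).re
      = ∫ y, (⟪f y, ((c : ℂ) • f : Lp ℂ 2 μ) y⟫_ℂ).re ∂μ := (integral_re e1).symm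
  have r2 : (∫ y, ⟪f y, mulOp a ha f y⟫_ℂ ∂μ).re
      = ∫ y, (⟪f y, mulOp a ha f y⟫_ℂ).re ∂μ := (integral_re e2).symm
  rw [r1, r2]
  refine integral_mono_ae e1.re e2.re ?_
  filter_upwards [hc, coeFn_mulOp a ha f, Lp.coeFn_smul (c : ℂ) f] with y hy h3 h4
  rw [h3, h4]
  simp only [RCLike.inner_apply, Pi.smul_apply, smul_eq_mul]
  have : ∀ b : ℝ, ((b : ℂ) * f y * (starRingEnd ℂ) (f y)).re = b * Complex.normSq (f y) := by
    intro b
    rw [mul_assoc, Complex.mul_conj, ← Complex.ofReal_mul, Complex.ofReal_re]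
  rw [this, this]
  exact mul_le_mul_of_nonneg_right hy (Complex.normSq_nonneg _)

end Multiplication

/-! ### Test functions -/

section Test

variable {d : ℕ} {Λ : Set (Space d)}

theorem IsTest.differentiable {φ : Space d → ℂ} (h : IsTest Λ φ) : Differentiable ℝ φ :=
  h.1.differentiable (by simp)

theorem IsTest.memLp {φ : Space d → ℂ} (h : IsTest Λ φ) :
    MemLp φ 2 ((volume : Measure (Space d)).restrict Λ) :=
  (h.1.continuous.memLp_of_hasCompactSupport h.2.1).restrict Λ

theorem IsTest.pderiv {φ : Space d → ℂ} (h : IsTest Λ φ) (i : Fin d) :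
    IsTest Λ (pderiv i φ) := by
  have hs : tsupport (PoissonLoc.pderiv i φ) ⊆ tsupport φ := by
    refine (closure_mono ?_).trans (tsupport_fderiv_subset ℝ)
    intro y hy h0
    exact hy (by simp [PoissonLoc.pderiv, h0])
  refine ⟨?_, h.2.1.mono' ((subset_tsupport _).trans hs), hs.trans h.2.2⟩
  exact (h.1.fderiv_right (m := ((⊤ : ℕ∞) : WithTop ℕ∞)) (by simp)).clm_apply contDiff_const

theorem IsTest.add {φ ψ : Space d → ℂ} (h : IsTest Λ φ) (k : IsTest Λ ψ) :
    IsTest Λ (φ + ψ) :=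
  ⟨h.1.add k.1, h.2.1.add k.2.1,
    (tsupport_add φ ψ).trans (union_subset h.2.2 k.2.2)⟩

theorem isTest_zero : IsTest Λ (0 : Space d → ℂ) :=
  ⟨contDiff_const, HasCompactSupport.zero, by simp [tsupport]⟩

theorem IsTest.mul_left {φ ψ : Space d → ℂ} (h : IsTest Λ φ)
    (k : ContDiff ℝ ((⊤ : ℕ∞) : WithTop ℕ∞) ψ) : IsTest Λ (ψ * φ) :=
  ⟨k.mul h.1, h.2.1.mul_left, (tsupport_mul_subset_right).trans h.2.2⟩

theorem IsTest.conj {φ : Space d → ℂ} (h : IsTest Λ φ) :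
    IsTest Λ (fun y => (starRingEnd ℂ) (φ y)) := by
  refine ⟨Complex.conjCLE.contDiff.comp h.1, h.2.1.comp_left (map_zero _), ?_⟩
  exact (tsupport_comp_subset (map_zero (starRingEnd ℂ)) φ).trans h.2.2

theorem pderiv_conj {φ : Space d → ℂ} (h : IsTest Λ φ) (i : Fin d) (y : Space d) :
    pderiv i (fun y => (starRingEnd ℂ) (φ y)) y = (starRingEnd ℂ) (pderiv i φ y) := by
  have h1 : HasFDerivAt (fun y => Complex.conjCLE (φ y))
      ((Complex.conjCLE : ℂ →L[ℝ] ℂ).comp (fderiv ℝ φ y)) y :=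
    (Complex.conjCLE : ℂ →L[ℝ] ℂ).hasFDerivAt.comp y (h.differentiable y).hasFDerivAt
  have h2 : fderiv ℝ (fun y => (starRingEnd ℂ) (φ y)) y
      = (Complex.conjCLE : ℂ →L[ℝ] ℂ).comp (fderiv ℝ φ y) := h1.fderiv
  rw [pderiv, h2]
  rfl

theorem pderiv_add {φ ψ : Space d → ℂ} (h : IsTest Λ φ) (k : IsTest Λ ψ) (i : Fin d) :
    pderiv i (φ + ψ) = pderiv i φ + pderiv i ψ := by
  funext y
  simp [pderiv, fderiv_add (h.differentiable y) (k.differentiable y)]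

theorem pderiv_mul {φ ψ : Space d → ℂ} (h : IsTest Λ φ)
    (k : Differentiable ℝ ψ) (i : Fin d) (y : Space d) :
    pderiv i (ψ * φ) y = ψ y * pderiv i φ y + pderiv i ψ y * φ y := by
  rw [pderiv, fderiv_mul (k y) (h.differentiable y)]
  simp [pderiv, mul_comm]

end Test

/-! ### The Dirichlet space -/

/-- The Hilbert space of pairs `(v, G)` of a function and a vector field on `Λ`, both square
integrable; the component `none` is `v` and the component `some i` is `G i`. -/
abbrev GradSpace {d : ℕ} (Λ : Set (Space d)) : Type :=
  PiLp 2 (fun _ : Option (Fin d) => L2 Λ)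

/-- The operator on `GradSpace Λ` with the given components. -/
def ofComponents {d : ℕ} {Λ : Set (Space d)} (T : Option (Fin d) → (GradSpace Λ →L[ℂ] L2 Λ)) :
    GradSpace Λ →L[ℂ] GradSpace Λ :=
  ((PiLp.continuousLinearEquiv 2 ℂ (fun _ : Option (Fin d) => L2 Λ)).symm :
    (∀ _ : Option (Fin d), L2 Λ) →L[ℂ] GradSpace Λ).comp (ContinuousLinearMap.pi T)

/-- The graph of the gradient on `C_c^∞(Λ)`. -/
def testGraph {d : ℕ} (Λ : Set (Space d)) : Submodule ℂ (GradSpace Λ) where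
  carrier := {w | ∃ φ, IsTest Λ φ ∧ (w none : Space d → ℂ) =ᵐ[volume.restrict Λ] φ ∧
    ∀ i, (w (some i) : Space d → ℂ) =ᵐ[volume.restrict Λ] pderiv i φ}
  add_mem' := by
    rintro w w' ⟨φ, h1, h2, h3⟩ ⟨φ', h1', h2', h3'⟩
    refine ⟨φ + φ', h1.add h1', ?_, fun i => ?_⟩
    · exact (Lp.coeFn_add _ _).trans (h2.add h2')
    · rw [pderiv_add h1 h1']
      exact (Lp.coeFn_add _ _).trans ((h3 i).add (h3' i))
  zero_mem' := by
    refine ⟨0, isTest_zero, Lp.coeFn_zero _ _ _, fun i => ?_⟩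
    have : pderiv i (0 : Space d → ℂ) = 0 := by
      funext y; simp [pderiv]
    rw [this]
    exact Lp.coeFn_zero _ _ _
  smul_mem' := by
    rintro c w ⟨φ, h1, h2, h3⟩
    refine ⟨(fun _ => c) * φ, h1.mul_left contDiff_const, ?_, fun i => ?_⟩
    · refine (Lp.coeFn_smul c _).trans ?_
      filter_upwards [h2] with y hy
      simp [hy]
    · refine (Lp.coeFn_smul c _).trans ?_
      filter_upwards [h3 i] with y hy
      rw [pderiv_mul h1 (differentiable_const c)]
      simp [hy, pderiv]

/-- The graph of the Dirichlet gradient, with domain `H^1_0(Λ)`. -/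
def dirichletGraph {d : ℕ} (Λ : Set (Space d)) : Submodule ℂ (GradSpace Λ) :=
  (testGraph Λ).topologicalClosure

instance {d : ℕ} (Λ : Set (Space d)) : CompleteSpace (dirichletGraph Λ) :=
  Submodule.topologicalClosure.completeSpace _

theorem exists_testGraph {d : ℕ} {Λ : Set (Space d)} {φ : Space d → ℂ} (h : IsTest Λ φ) :
    ∃ w ∈ testGraph Λ, (w none : Space d → ℂ) =ᵐ[volume.restrict Λ] φ ∧
      ∀ i, (w (some i) : Space d → ℂ) =ᵐ[volume.restrict Λ] pderiv i φ := by
  let w : GradSpace Λ := WithLp.toLp 2 fun o =>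
    Option.elim o (h.memLp.toLp φ) (fun i => ((h.pderiv i).memLp.toLp (pderiv i φ)))
  have h1 : (w none : Space d → ℂ) =ᵐ[volume.restrict Λ] φ := h.memLp.coeFn_toLp
  have h2 : ∀ i, (w (some i) : Space d → ℂ) =ᵐ[volume.restrict Λ] pderiv i φ :=
    fun i => (h.pderiv i).memLp.coeFn_toLp
  exact ⟨w, ⟨φ, h, h1, h2⟩, h1, h2⟩

theorem hasDirichletGradient_iff {d : ℕ} {Λ : Set (Space d)} (w : GradSpace Λ) :
    HasDirichletGradient (w none) (fun i => w (some i)) ↔ w ∈ dirichletGraph Λ := by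
  have key : ∀ (x : ℕ → GradSpace Λ) (φ : ℕ → Space d → ℂ),
      (∀ n, ((x n) none : Space d → ℂ) =ᵐ[volume.restrict Λ] φ n) →
      (∀ n i, ((x n) (some i) : Space d → ℂ) =ᵐ[volume.restrict Λ] pderiv i (φ n)) →
      (Tendsto x atTop (𝓝 w) ↔
        Tendsto (fun n => eLpNorm (fun y => φ n y - w none y) 2 (volume.restrict Λ)) atTop (𝓝 0) ∧
        ∀ i, Tendsto (fun n => eLpNorm (fun y => pderiv i (φ n) y - w (some i) y) 2
          (volume.restrict Λ)) atTop (𝓝 0)) := by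
    intro x φ h1 h2
    have e : Tendsto x atTop (𝓝 w) ↔
        ∀ o, Tendsto (fun n => (x n) o) atTop (𝓝 (w o)) := by
      rw [← tendsto_pi_nhds]
      exact (PiLp.continuousLinearEquiv 2 ℂ
        (fun _ : Option (Fin d) => L2 Λ)).toHomeomorph.isInducing.tendsto_nhds_iff
    rw [e, Option.forall]
    refine and_congr ?_ (forall_congr' fun i => ?_)
    · rw [Lp.tendsto_Lp_iff_tendsto_eLpNorm']
      refine tendsto_congr fun n => eLpNorm_congr_ae ?_
      filter_upwards [h1 n] with y hy
      simp [hy]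
    · rw [Lp.tendsto_Lp_iff_tendsto_eLpNorm']
      refine tendsto_congr fun n => eLpNorm_congr_ae ?_
      filter_upwards [h2 n i] with y hy
      simp [hy]
  have hcl : w ∈ dirichletGraph Λ ↔ w ∈ closure (testGraph Λ : Set (GradSpace Λ)) := by
    rw [dirichletGraph, ← SetLike.mem_coe, Submodule.topologicalClosure_coe]
  rw [hcl, mem_closure_iff_seq_limit]
  constructor
  · rintro ⟨φ, h1, h2⟩
    choose x hx hx1 hx2 using fun n => exists_testGraph (h1 n)
    exact ⟨x, hx, (key x φ hx1 hx2).2 h2⟩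
  · rintro ⟨x, hx, hlim⟩
    choose φ h1 h2 h3 using hx
    exact ⟨φ, h1, (key x φ h2 h3).1 hlim⟩

open scoped InnerProductSpace

theorem inner_gradSpace {d : ℕ} {Λ : Set (Space d)} (w w' : GradSpace Λ) :
    ⟪w, w'⟫_ℂ = ⟪w none, w' none⟫_ℂ + ∑ i, ⟪w (some i), w' (some i)⟫_ℂ := by
  rw [PiLp.inner_apply, Fintype.sum_option]

/-- The form `(v, G) ↦ (a v, G)` of the operator `-Δ + a`, as an operator on `GradSpace Λ`. -/
def formOp {d : ℕ} {Λ : Set (Space d)} (a : Space d → ℝ)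
    (ha : EssBounded ((volume : Measure (Space d)).restrict Λ) a) :
    GradSpace Λ →L[ℂ] GradSpace Λ :=
  ofComponents fun o => Option.elim o ((mulOp a ha).comp (PiLp.proj 2 _ none))
    (fun i => PiLp.proj 2 _ (some i))

theorem inner_formOp {d : ℕ} {Λ : Set (Space d)} (a : Space d → ℝ)
    (ha : EssBounded ((volume : Measure (Space d)).restrict Λ) a) (q w : GradSpace Λ) :
    ⟪q, formOp a ha w⟫_ℂ
      = ⟪q none, mulOp a ha (w none)⟫_ℂ + ∑ i, ⟪q (some i), w (some i)⟫_ℂ :=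
  inner_gradSpace _ _

/-- The Hamiltonian `-Δ_Λ + V` in variational form, with test functions in `H^1_0(Λ)` and the
energy `E` moved to the left hand side. -/
theorem hamiltonian_iff {d : ℕ} {Λ : Set (Space d)} (V : Space d → ℝ) (E : ℝ)
    (ha : EssBounded ((volume : Measure (Space d)).restrict Λ) (fun y => V y - E)) (v g : L2 Λ) :
    Hamiltonian V v g ↔ ∃ w ∈ dirichletGraph Λ, w none = v ∧
      ∀ q ∈ dirichletGraph Λ,
        ⟪q, formOp _ ha w⟫_ℂ = ⟪q, PiLp.single 2 none (g - (E : ℂ) • v)⟫_ℂ := by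
  have hint : ∀ (φ : Space d → ℂ) (h : L2 Λ), IsTest Λ φ →
      Integrable (fun y => φ y * h y) (volume.restrict Λ) := fun φ h hφ =>
    (Lp.memLp h).integrable_mul hφ.memLp |>.congr (by
      filter_upwards with y; simp [mul_comm])
  -- the form identity for a test function `φ`, and for the element of the graph given by `conj φ`
  have key : ∀ (w q : GradSpace Λ) (φ : Space d → ℂ), IsTest Λ φ →
      ((q none : Space d → ℂ) =ᵐ[volume.restrict Λ] fun y => (starRingEnd ℂ) (φ y)) →
      (∀ i, (q (some i) : Space d → ℂ) =ᵐ[volume.restrict Λ]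
        fun y => (starRingEnd ℂ) (pderiv i φ y)) →
      w none = v →
      (⟪q, formOp _ ha w⟫_ℂ = ⟪q, PiLp.single 2 none (g - (E : ℂ) • v)⟫_ℂ ↔
        (∑ i, ∫ y in Λ, pderiv i φ y * w (some i) y) + ∫ y in Λ, φ y * ((V y : ℂ) * v y)
          = ∫ y in Λ, φ y * g y) := by
    intro w q φ hφ h1 h2 hw
    rw [inner_formOp, inner_gradSpace, hw]
    have e : ∀ h : L2 Λ, ⟪q none, h⟫_ℂ = ∫ y in Λ, φ y * h y := by
      intro h
      rw [L2.inner_def]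
      refine integral_congr_ae ?_
      filter_upwards [h1] with y hy
      rw [hy]
      simp [RCLike.inner_apply, mul_comm]
    have e1 : ⟪q none, mulOp _ ha v⟫_ℂ
        = (∫ y in Λ, φ y * ((V y : ℂ) * v y)) - E * ∫ y in Λ, φ y * v y := by
      have i1 := hint φ (mulOp _ ha v) hφ
      have i2 := (hint φ v hφ).const_mul (E : ℂ)
      rw [e, eq_sub_iff_add_eq, ← integral_const_mul, ← integral_add i1 i2]
      refine integral_congr_ae ?_
      filter_upwards [coeFn_mulOp _ ha v] with y hy
      rw [hy]
      push_cast
      ring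
    have e2 : ∀ i, ⟪q (some i), w (some i)⟫_ℂ = ∫ y in Λ, pderiv i φ y * w (some i) y := by
      intro i
      rw [L2.inner_def]
      refine integral_congr_ae ?_
      filter_upwards [h2 i] with y hy
      rw [hy]
      simp [RCLike.inner_apply, mul_comm]
    have e3 : ⟪q none, g - (E : ℂ) • v⟫_ℂ
        = (∫ y in Λ, φ y * g y) - E * ∫ y in Λ, φ y * v y := by
      rw [inner_sub_right, inner_smul_right, e, e]
    have e4 : ∀ i, ⟪q (some i), (PiLp.single 2 none (g - (E : ℂ) • v) : GradSpace Λ) (some i)⟫_ℂ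
        = 0 := by
      intro i
      rw [PiLp.single_eq_of_ne 2 (Option.some_ne_none i), inner_zero_right]
    rw [PiLp.single_eq_same, e1, e3, Finset.sum_congr rfl fun i _ => e2 i,
      Finset.sum_congr rfl fun i _ => e4 i, Finset.sum_const_zero, add_zero]
    constructor <;> intro h <;> linear_combination h
  constructor
  · rintro ⟨G, hG, h⟩
    let w : GradSpace Λ := WithLp.toLp 2 fun o => Option.elim o v G
    have hw : w ∈ dirichletGraph Λ := (hasDirichletGradient_iff w).1 hG
    refine ⟨w, hw, rfl, fun q hq => ?_⟩
    have hclosed : IsClosed {q : GradSpace Λ |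
        ⟪q, formOp _ ha w⟫_ℂ = ⟪q, PiLp.single 2 none (g - (E : ℂ) • v)⟫_ℂ} :=
      isClosed_eq (by fun_prop) (by fun_prop)
    have hq' : q ∈ closure (testGraph Λ : Set (GradSpace Λ)) := by
      rw [← Submodule.topologicalClosure_coe]
      exact hq
    refine closure_minimal ?_ hclosed hq'
    rintro q ⟨φ, hφ, h1, h2⟩
    refine (key w q _ hφ.conj ?_ ?_ rfl).2 (h _ hφ.conj)
    · simpa using h1
    · intro i
      simpa [pderiv_conj hφ] using h2 i
  · rintro ⟨w, hw, hwv, h⟩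
    refine ⟨fun i => w (some i), hwv ▸ (hasDirichletGradient_iff w).2 hw, fun φ hφ => ?_⟩
    obtain ⟨q, hq, h1, h2⟩ := exists_testGraph hφ.conj
    refine (key w q φ hφ h1 ?_ hwv).1 (h q (Submodule.le_topologicalClosure _ hq))
    intro i
    rw [← funext (pderiv_conj hφ i)]
    exact h2 i

/-! ### The resolvent of a coercive Hamiltonian -/

section Resolvent

variable {d : ℕ} {Λ : Set (Space d)}

/-- The embedding `f ↦ (f, 0)` of `L²(Λ)`. -/
def inlGrad : L2 Λ →L[ℂ] GradSpace Λ :=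
  ((PiLp.continuousLinearEquiv 2 ℂ (fun _ : Option (Fin d) => L2 Λ)).symm :
    (∀ _ : Option (Fin d), L2 Λ) →L[ℂ] GradSpace Λ).comp
    (ContinuousLinearMap.pi fun o => Option.elim o (ContinuousLinearMap.id ℂ _) (fun _ => 0))

theorem inlGrad_apply (f : L2 Λ) : (inlGrad f : GradSpace Λ) = PiLp.single 2 none f := by
  ext1 o
  cases o with
  | none => rw [PiLp.single_eq_same]; rfl
  | some i => rw [PiLp.single_eq_of_ne 2 (Option.some_ne_none i)]; rfl

/-- `v` solves `(-Δ_Λ + a) v = f` weakly, where `w = (v, ∇v)`. -/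
def IsWeakSolution (a : Space d → ℝ) (ha : EssBounded ((volume : Measure (Space d)).restrict Λ) a)
    (w : GradSpace Λ) (f : L2 Λ) : Prop :=
  w ∈ dirichletGraph Λ ∧
    ∀ q ∈ dirichletGraph Λ, ⟪q, formOp a ha w⟫_ℂ = ⟪q, PiLp.single 2 none f⟫_ℂ

theorem inner_single_none (q : GradSpace Λ) (f : L2 Λ) :
    ⟪q, (PiLp.single 2 none f : GradSpace Λ)⟫_ℂ = ⟪q none, f⟫_ℂ := by
  rw [inner_gradSpace, PiLp.single_eq_same, Finset.sum_eq_zero, add_zero]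
  intro i _
  rw [PiLp.single_eq_of_ne 2 (Option.some_ne_none i), inner_zero_right]

theorem norm_sq_gradSpace (w : GradSpace Λ) :
    ‖w‖ ^ 2 = ‖w none‖ ^ 2 + ∑ i, ‖w (some i)‖ ^ 2 := by
  rw [PiLp.norm_sq_eq_of_L2, Fintype.sum_option]

theorem norm_sq_le_re_inner_formOp (a : Space d → ℝ)
    (ha : EssBounded ((volume : Measure (Space d)).restrict Λ) a)
    (h1 : ∀ᵐ y ∂(volume : Measure (Space d)).restrict Λ, 1 ≤ a y) (w : GradSpace Λ) :
    ‖w‖ ^ 2 ≤ (⟪w, formOp a ha w⟫_ℂ).re := by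
  rw [inner_formOp, norm_sq_gradSpace, Complex.add_re, Complex.re_sum]
  refine add_le_add ?_ (Finset.sum_le_sum fun i _ => ?_)
  · simpa using le_re_inner_mulOp a ha 1 h1 (w none)
  · exact (inner_self_eq_norm_sq (𝕜 := ℂ) (w (some i))).ge

/-- If `V - E ≥ 1`, then `E` is in the resolvent set of `-Δ_Λ + V`, the resolvent has norm at most
one and its values are weak solutions. -/
theorem exists_isResolvent (V : Space d → ℝ) (E : ℝ)
    (ha : EssBounded ((volume : Measure (Space d)).restrict Λ) (fun y => V y - E))
    (h1 : ∀ᵐ y ∂(volume : Measure (Space d)).restrict Λ, 1 ≤ V y - E) :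
    ∃ R : L2 Λ →L[ℂ] L2 Λ, IsResolvent V E R ∧ ‖R‖ ≤ 1 ∧
      ∀ f, ∃ w, IsWeakSolution _ ha w f ∧ w none = R f := by
  obtain ⟨Sol, hS1, hS2⟩ := exists_solution_operator (dirichletGraph Λ) (formOp _ ha)
    fun w _ => norm_sq_le_re_inner_formOp _ ha h1 w
  let R : L2 Λ →L[ℂ] L2 Λ :=
    (PiLp.proj 2 (fun _ : Option (Fin d) => L2 Λ) none).comp
      ((dirichletGraph Λ).subtypeL.comp (Sol.comp inlGrad))
  have hR : ∀ f, R f = (Sol (inlGrad f) : GradSpace Λ) none := fun f => rfl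
  have hw : ∀ f, IsWeakSolution _ ha (Sol (inlGrad f) : GradSpace Λ) f := by
    refine fun f => ⟨(Sol (inlGrad f)).2, fun q hq => ?_⟩
    rw [← inlGrad_apply]
    exact hS1 _ q hq
  refine ⟨R, ⟨fun f => ?_, fun v g h => ?_⟩, ?_, fun f => ⟨_, hw f, (hR f).symm⟩⟩
  · rw [hamiltonian_iff V E ha]
    refine ⟨_, (hw f).1, (hR f).symm, ?_⟩
    rw [add_sub_cancel_right]
    exact (hw f).2
  · obtain ⟨w, hw1, rfl, hw2⟩ := (hamiltonian_iff V E ha v g).1 h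
    rw [hR, hS2 w _ hw1 (by rw [inlGrad_apply]; exact hw2)]
  · refine R.opNorm_le_bound zero_le_one fun f => ?_
    rw [one_mul, hR]
    set w : GradSpace Λ := (Sol (inlGrad f) : GradSpace Λ) with hwdef
    have e1 : ‖w‖ ^ 2 ≤ ‖w none‖ * ‖f‖ := by
      refine (norm_sq_le_re_inner_formOp _ ha h1 w).trans ?_
      rw [(hw f).2 w (hw f).1, inner_single_none]
      exact re_inner_le_norm (𝕜 := ℂ) _ _
    have e2 : ‖w none‖ ^ 2 ≤ ‖w‖ ^ 2 := by
      rw [norm_sq_gradSpace]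
      exact le_add_of_nonneg_right (Finset.sum_nonneg fun i _ => sq_nonneg _)
    have e3 : ‖w none‖ * ‖w none‖ ≤ ‖w none‖ * ‖f‖ := by rw [← sq]; exact e2.trans e1
    rcases (norm_nonneg (w none)).eq_or_lt with h0 | h0
    · rw [← h0]; exact norm_nonneg f
    · exact le_of_mul_le_mul_left e3 h0

/-- `H^1_0(Λ)` is stable under multiplication by smooth functions, with the product rule. -/
theorem exists_mul_mem_dirichletGraph (ψ : Space d → ℝ)
    (hψ : ContDiff ℝ ((⊤ : ℕ∞) : WithTop ℕ∞) ψ)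
    (b : Fin d → Space d → ℝ) (hb : ∀ i y, pderiv i (fun y => (ψ y : ℂ)) y = b i y)
    (hψb : EssBounded ((volume : Measure (Space d)).restrict Λ) ψ)
    (hbb : ∀ i, EssBounded ((volume : Measure (Space d)).restrict Λ) (b i))
    (w : GradSpace Λ) (hw : w ∈ dirichletGraph Λ) :
    ∃ q ∈ dirichletGraph Λ, q none = mulOp ψ hψb (w none) ∧
      ∀ i, q (some i) = mulOp ψ hψb (w (some i)) + mulOp (b i) (hbb i) (w none) := by
  let M : GradSpace Λ →L[ℂ] GradSpace Λ := ofComponents fun o => Option.elim o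
    ((mulOp ψ hψb).comp (PiLp.proj 2 _ none))
    (fun i => (mulOp ψ hψb).comp (PiLp.proj 2 _ (some i))
      + (mulOp (b i) (hbb i)).comp (PiLp.proj 2 _ none))
  have hM0 : ∀ w, M w none = mulOp ψ hψb (w none) := fun w => rfl
  have hM1 : ∀ w i, M w (some i) = mulOp ψ hψb (w (some i)) + mulOp (b i) (hbb i) (w none) :=
    fun w i => rfl
  refine ⟨M w, ?_, hM0 w, hM1 w⟩
  have hw' : w ∈ closure (testGraph Λ : Set (GradSpace Λ)) := by
    rw [← Submodule.topologicalClosure_coe]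
    exact hw
  have hmaps : MapsTo M (testGraph Λ) (testGraph Λ) := by
    rintro w ⟨φ, hφ, h1, h2⟩
    have hψc : ContDiff ℝ ((⊤ : ℕ∞) : WithTop ℕ∞) (fun y => (ψ y : ℂ)) :=
      Complex.ofRealCLM.contDiff.comp hψ
    refine ⟨(fun y => (ψ y : ℂ)) * φ, hφ.mul_left hψc, ?_, fun i => ?_⟩
    · rw [hM0]
      filter_upwards [coeFn_mulOp ψ hψb (w none), h1] with y hy hy1
      rw [hy, hy1, Pi.mul_apply]
    · rw [hM1]
      filter_upwards [Lp.coeFn_add (mulOp ψ hψb (w (some i))) (mulOp (b i) (hbb i) (w none)),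
        coeFn_mulOp ψ hψb (w (some i)), coeFn_mulOp (b i) (hbb i) (w none), h1, h2 i]
        with y e0 e1 e2 e3 e4
      rw [e0, Pi.add_apply, e1, e2, e3, e4, pderiv_mul hφ (hψc.differentiable (by simp)), hb]
  have h3 := map_mem_closure M.continuous hw' hmaps
  rw [← Submodule.topologicalClosure_coe] at h3
  exact h3

/-! ### Exponential decay -/

/-- The exponential weight `exp (m ⟪e, y⟫)`. -/
def expWeight (m : ℝ) (e y : Space d) : ℝ := Real.exp (m * ⟪e, y⟫_ℝ)

theorem contDiff_expWeight (m : ℝ) (e : Space d) :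
    ContDiff ℝ ((⊤ : ℕ∞) : WithTop ℕ∞) (expWeight m e) :=
  (contDiff_const.mul (contDiff_const.inner ℝ contDiff_id)).exp

theorem pderiv_expWeight (m : ℝ) (e : Space d) (i : Fin d) (y : Space d) :
    pderiv i (fun y => (expWeight m e y : ℂ)) y = ((m * e i * expWeight m e y : ℝ) : ℂ) := by
  have h0 : HasFDerivAt (fun y : Space d => ⟪e, y⟫_ℝ) (innerSL ℝ e) y :=
    (innerSL ℝ e).hasFDerivAt
  have h1 : HasFDerivAt (expWeight m e) (expWeight m e y • (m • innerSL ℝ e)) y :=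
    (h0.const_mul m).exp
  have h2 : HasFDerivAt (fun y => (expWeight m e y : ℂ))
      (Complex.ofRealCLM.comp (expWeight m e y • (m • innerSL ℝ e))) y :=
    Complex.ofRealCLM.hasFDerivAt.comp y h1
  rw [pderiv, h2.fderiv]
  simp [EuclideanSpace.inner_single_right]
  ring

theorem essBounded_of_continuous (hΛ : Bornology.IsBounded Λ) (hm : MeasurableSet Λ)
    (a : Space d → ℝ) (ha : Continuous a) :
    EssBounded ((volume : Measure (Space d)).restrict Λ) a := by
  refine ⟨ha.aestronglyMeasurable, ?_⟩
  obtain ⟨c, hc⟩ := hΛ.isCompact_closure.exists_bound_of_continuousOn ha.continuousOn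
  refine ⟨c, (ae_restrict_iff' hm).2 (Eventually.of_forall fun y hy => ?_)⟩
  exact hc y (subset_closure hy)

/-- The weighted energy estimate behind the exponential decay (Combes–Thomas): testing the
equation with `ψ² v` for an exponential weight `ψ` of rate `m`, the gradient terms cost at most
`m² ‖ψ v‖²`. -/
theorem norm_mulOp_expWeight_le (hΛ : Bornology.IsBounded Λ) (hmΛ : MeasurableSet Λ)
    (a : Space d → ℝ) (ha : EssBounded ((volume : Measure (Space d)).restrict Λ) a) (m : ℝ)
    (h1 : ∀ᵐ y ∂(volume : Measure (Space d)).restrict Λ, 1 + m ^ 2 ≤ a y)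
    (e : Space d) (he : ‖e‖ ≤ 1) (w : GradSpace Λ) (f : L2 Λ) (hw : IsWeakSolution a ha w f)
    (hψ : EssBounded ((volume : Measure (Space d)).restrict Λ) (expWeight m e)) :
    ‖mulOp (expWeight m e) hψ (w none)‖ ≤ ‖mulOp (expWeight m e) hψ f‖ := by
  have hψ2 : EssBounded ((volume : Measure (Space d)).restrict Λ) (expWeight (2 * m) e) :=
    essBounded_of_continuous hΛ hmΛ _ (contDiff_expWeight _ _).continuous
  have hb : ∀ i, EssBounded ((volume : Measure (Space d)).restrict Λ)
      (fun y => 2 * m * e i * expWeight (2 * m) e y) := fun i =>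
    essBounded_of_continuous hΛ hmΛ _ (continuous_const.mul (contDiff_expWeight _ _).continuous)
  obtain ⟨q, hq, hq0, hq1⟩ := exists_mul_mem_dirichletGraph (expWeight (2 * m) e)
    (contDiff_expWeight _ _) (fun i y => 2 * m * e i * expWeight (2 * m) e y)
    (fun i y => pderiv_expWeight _ e i y) hψ2 hb w hw.1
  have hsq : ∀ h : L2 Λ, mulOp (expWeight (2 * m) e) hψ2 h
      = mulOp (expWeight m e) hψ (mulOp (expWeight m e) hψ h) := by
    refine fun h => (mulOp_mulOp _ _ _ hψ hψ hψ2 (fun y => ?_) h).symm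
    rw [expWeight, expWeight, ← Real.exp_add]
    ring_nf
  have hbsq : ∀ i (h : L2 Λ), mulOp _ (hb i) h
      = ((2 * m * e i : ℝ) : ℂ) • mulOp (expWeight (2 * m) e) hψ2 h := by
    refine fun i h => Lp.ext ?_
    filter_upwards [coeFn_mulOp _ (hb i) h, coeFn_mulOp _ hψ2 h,
      Lp.coeFn_smul ((2 * m * e i : ℝ) : ℂ) (mulOp (expWeight (2 * m) e) hψ2 h)] with y e1 e2 e3
    rw [e1, e3, Pi.smul_apply, e2, smul_eq_mul]
    push_cast
    ring
  set n : L2 Λ := mulOp (expWeight m e) hψ (w none) with hn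
  have key := hw.2 q hq
  rw [inner_single_none, inner_formOp, hq0, hsq, inner_mulOp_left, ← hn, mulOp_comm, ← hn,
    inner_mulOp_left _ _ _ f] at key
  have hgrad : ∀ i, -(m ^ 2 * (e i) ^ 2 * ‖n‖ ^ 2) ≤ (⟪q (some i), w (some i)⟫_ℂ).re := by
    intro i
    set g : L2 Λ := mulOp (expWeight m e) hψ (w (some i)) with hg
    have e1 : ⟪q (some i), w (some i)⟫_ℂ = ⟪g, g⟫_ℂ + ((2 * m * e i : ℝ) : ℂ) * ⟪n, g⟫_ℂ := by
      rw [hq1, hbsq, hsq, hsq, inner_add_left, inner_smul_left, inner_mulOp_left, ← hg, ← hn,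
        inner_mulOp_left _ _ n, ← hg, Complex.conj_ofReal]
    have e2 : (⟪g, g⟫_ℂ).re = ‖g‖ ^ 2 := inner_self_eq_norm_sq (𝕜 := ℂ) g
    have e3 := norm_add_sq (𝕜 := ℂ) (((m * e i : ℝ) : ℂ) • n) g
    have e4 : RCLike.re ⟪((m * e i : ℝ) : ℂ) • n, g⟫_ℂ = m * e i * (⟪n, g⟫_ℂ).re := by
      rw [inner_smul_left, Complex.conj_ofReal]
      exact Complex.re_ofReal_mul _ _
    have e5 : ‖((m * e i : ℝ) : ℂ) • n‖ ^ 2 = m ^ 2 * (e i) ^ 2 * ‖n‖ ^ 2 := by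
      rw [norm_smul, Complex.norm_real, Real.norm_eq_abs, mul_pow, sq_abs, mul_pow]
    rw [e4, e5] at e3
    rw [e1, Complex.add_re, e2, Complex.re_ofReal_mul]
    nlinarith [sq_nonneg ‖((m * e i : ℝ) : ℂ) • n + g‖]
  have hgrad' : -(m ^ 2 * ‖n‖ ^ 2) ≤ ∑ i, (⟪q (some i), w (some i)⟫_ℂ).re := by
    refine le_trans ?_ (Finset.sum_le_sum fun i _ => hgrad i)
    rw [Finset.sum_neg_distrib, ← Finset.sum_mul, ← Finset.mul_sum]
    have e1 : ∑ i, (e i) ^ 2 = ‖e‖ ^ 2 := (EuclideanSpace.real_norm_sq_eq e).symm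
    have e2 : ‖e‖ ^ 2 ≤ 1 := pow_le_one₀ (norm_nonneg e) he
    rw [e1]
    have e3 : m ^ 2 * ‖e‖ ^ 2 * ‖n‖ ^ 2 ≤ m ^ 2 * 1 * ‖n‖ ^ 2 := by gcongr
    linarith
  have hpot := le_re_inner_mulOp a ha (1 + m ^ 2) h1 n
  have hre := congrArg Complex.re key
  rw [Complex.add_re, Complex.re_sum] at hre
  have hcs : (⟪n, mulOp (expWeight m e) hψ f⟫_ℂ).re ≤ ‖n‖ * ‖mulOp (expWeight m e) hψ f‖ :=
    re_inner_le_norm (𝕜 := ℂ) _ _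
  have hfin : ‖n‖ * ‖n‖ ≤ ‖n‖ * ‖mulOp (expWeight m e) hψ f‖ := by nlinarith
  rcases (norm_nonneg n).eq_or_lt with h0 | h0
  · rw [← h0]; exact norm_nonneg _
  · exact le_of_mul_le_mul_left hfin h0

theorem norm_sub_le_of_mem_box {y p : Space d} {s : ℝ} (h : p ∈ box s y) :
    ‖p - y‖ ≤ d * (s / 2) := by
  have h1 : ‖p - y‖ ≤ ∑ i, ‖(p - y) i‖ := by
    conv_lhs => rw [← (EuclideanSpace.basisFun (Fin d) ℝ).sum_repr (p - y)]
    refine (norm_sum_le _ _).trans (Finset.sum_le_sum fun i _ => ?_)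
    simp [norm_smul]
  refine h1.trans ?_
  have h2 : ∑ i : Fin d, ‖(p - y) i‖ ≤ ∑ _i : Fin d, s / 2 :=
    Finset.sum_le_sum fun i _ => (h i).le
  simpa using h2

/-- Exponential decay of the solution operator between unit boxes. -/
theorem norm_chi_comp_chi_le (hΛ : Bornology.IsBounded Λ) (hmΛ : MeasurableSet Λ)
    (a : Space d → ℝ) (ha : EssBounded ((volume : Measure (Space d)).restrict Λ) a) (m : ℝ)
    (hm : 0 ≤ m)
    (h1 : ∀ᵐ y ∂(volume : Measure (Space d)).restrict Λ, 1 + m ^ 2 ≤ a y)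
    (R : L2 Λ →L[ℂ] L2 Λ) (hR : ∀ f, ∃ w, IsWeakSolution a ha w f ∧ w none = R f)
    (y z : Space d) :
    ‖(chi y).comp (R.comp (chi z))‖ ≤ Real.exp (-m * (‖y - z‖ - d)) := by
  set e : Space d := (‖y - z‖)⁻¹ • (y - z) with he
  have he1 : ‖e‖ ≤ 1 := by
    rw [he, norm_smul, norm_inv, norm_norm]
    exact inv_mul_le_one
  have heyz : ⟪e, y⟫_ℝ - ⟪e, z⟫_ℝ = ‖y - z‖ := by
    rw [← inner_sub_right, he, real_inner_smul_left, real_inner_self_eq_norm_sq, sq]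
    rcases (norm_nonneg (y - z)).eq_or_lt with h0 | h0
    · rw [← h0]; simp
    · field_simp
  have hbox : ∀ c p : Space d, p ∈ box 1 c → |⟪e, p⟫_ℝ - ⟪e, c⟫_ℝ| ≤ d / 2 := by
    intro c p hp
    rw [← inner_sub_right]
    refine (abs_real_inner_le_norm _ _).trans ?_
    have h2 := norm_sub_le_of_mem_box hp
    calc ‖e‖ * ‖p - c‖ ≤ 1 * ‖p - c‖ := by gcongr
      _ ≤ d / 2 := by linarith
  have hψ : EssBounded ((volume : Measure (Space d)).restrict Λ) (expWeight m e) :=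
    essBounded_of_continuous hΛ hmΛ _ (contDiff_expWeight _ _).continuous
  refine ContinuousLinearMap.opNorm_le_bound _ (Real.exp_pos _).le fun h => ?_
  obtain ⟨w, hw, hwR⟩ := hR (chi z h)
  have hmain := norm_mulOp_expWeight_le hΛ hmΛ a ha m h1 e he1 w _ hw hψ
  rw [hwR] at hmain
  have hleft : ‖chi y (R (chi z h))‖
      ≤ Real.exp (-m * (⟪e, y⟫_ℝ - d / 2)) * ‖mulOp (expWeight m e) hψ (R (chi z h))‖ := by
    refine Lp.norm_le_mul_norm_of_ae_le_mul ?_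
    filter_upwards [coeFn_cutoffLin (box 1 y) (isOpen_box 1 y).measurableSet (R (chi z h)),
      coeFn_mulOp _ hψ (R (chi z h))] with p e1 e2
    rw [show (chi y (R (chi z h)) : Space d → ℂ) p = _ from e1, e2, norm_mul, Complex.norm_real,
      Real.norm_eq_abs, expWeight, Real.abs_exp, ← mul_assoc, ← Real.exp_add]
    by_cases hp : p ∈ box 1 y
    · rw [indicator_of_mem hp]
      refine le_mul_of_one_le_left (norm_nonneg _) (Real.one_le_exp ?_)
      have := (abs_le.1 (hbox y p hp)).1
      nlinarith
    · rw [indicator_of_notMem hp, norm_zero]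
      positivity
  have hright : ‖mulOp (expWeight m e) hψ (chi z h)‖
      ≤ Real.exp (m * (⟪e, z⟫_ℝ + d / 2)) * ‖h‖ := by
    refine Lp.norm_le_mul_norm_of_ae_le_mul ?_
    filter_upwards [coeFn_cutoffLin (box 1 z) (isOpen_box 1 z).measurableSet h,
      coeFn_mulOp _ hψ (chi z h)] with p e1 e2
    rw [e2, show (chi z h : Space d → ℂ) p = _ from e1, norm_mul, Complex.norm_real,
      Real.norm_eq_abs, expWeight, Real.abs_exp]
    by_cases hp : p ∈ box 1 z
    · rw [indicator_of_mem hp]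
      have := (abs_le.1 (hbox z p hp)).2
      gcongr
      linarith
    · rw [indicator_of_notMem hp, norm_zero, mul_zero]
      positivity
  calc ‖chi y (R (chi z h))‖
      ≤ Real.exp (-m * (⟪e, y⟫_ℝ - d / 2)) * (Real.exp (m * (⟪e, z⟫_ℝ + d / 2)) * ‖h‖) :=
        hleft.trans (by gcongr; exact hmain.trans hright)
    _ = Real.exp (-m * (‖y - z‖ - d)) * ‖h‖ := by
        rw [← mul_assoc, ← Real.exp_add, ← heyz]
        congr 2
        ring

end Resolvent

/-! ### Boxes -/

section Boxes

variable {d : ℕ}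

theorem box_subset_box {a ℓ : ℝ} {c z : Space d} (h : ∀ i, |c i - z i| + a / 2 ≤ ℓ / 2) :
    box a c ⊆ box ℓ z := by
  intro y hy i
  have h1 := abs_add_le (y i - c i) (c i - z i)
  rw [sub_add_sub_cancel] at h1
  have h2 := hy i
  have h3 := h i
  linarith

theorem self_mem_box {a : ℝ} (ha : 0 < a) (c : Space d) : c ∈ box a c := by
  intro i
  simp only [sub_self, abs_zero]
  linarith

theorem mem_box_comm {a : ℝ} {y c : Space d} : y ∈ box a c ↔ c ∈ box a y := by
  simp only [box, mem_ofPred_eq, abs_sub_comm]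

theorem isBounded_box (L : ℝ) (x : Space d) : Bornology.IsBounded (box L x) :=
  (Metric.isBounded_closedBall (x := x) (r := d * (L / 2))).subset fun y hy => by
    rw [Metric.mem_closedBall, dist_eq_norm]
    exact norm_sub_le_of_mem_box hy

theorem volume_box (a : ℝ) (c : Space d) : volume (box a c) = ENNReal.ofReal a ^ d := by
  have h : box a c = (WithLp.ofLp (p := 2) : Space d → (Fin d → ℝ)) ⁻¹'
      (Set.univ.pi fun i => Ioo (c i - a / 2) (c i + a / 2)) := by
    ext y
    simp only [box, mem_ofPred_eq, mem_preimage, Set.mem_univ_pi, mem_Ioo]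
    refine forall_congr' fun i => ?_
    rw [abs_lt]
    constructor <;> rintro ⟨h1, h2⟩ <;> constructor <;> linarith
  rw [h, (PiLp.volume_preserving_ofLp (Fin d)).measure_preimage
    (MeasurableSet.univ_pi fun _ => measurableSet_Ioo).nullMeasurableSet, Real.volume_pi_Ioo]
  simp

theorem measurableSet_box (a : ℝ) (c : Space d) : MeasurableSet (box a c) :=
  (isOpen_box a c).measurableSet

/-! ### Lattices of boxes -/

/-- The point `x + a k` of the lattice `x + a ℤ^d`. -/
def lat (a : ℝ) (x : Space d) (k : Fin d → ℤ) : Space d :=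
  WithLp.toLp 2 fun i => x i + a * k i

@[simp] theorem lat_apply (a : ℝ) (x : Space d) (k : Fin d → ℤ) (i : Fin d) :
    lat a x k i = x i + a * k i := rfl

theorem eq_of_mem_box_lat {a : ℝ} (ha : 0 < a) {x : Space d} {k k' : Fin d → ℤ} {y : Space d}
    (h : y ∈ box a (lat a x k)) (h' : y ∈ box a (lat a x k')) : k = k' := by
  funext i
  have h1 := abs_lt.1 (h i)
  have h2 := abs_lt.1 (h' i)
  simp only [lat_apply] at h1 h2
  have h3 : ((k i : ℝ)) < k' i + 1 := by
    by_contra hc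
    nlinarith
  have h4 : ((k' i : ℝ)) < k i + 1 := by
    by_contra hc
    nlinarith
  have h3' : k i < k' i + 1 := by exact_mod_cast h3
  have h4' : k' i < k i + 1 := by exact_mod_cast h4
  omega

/-- Every point of `Λ_L(x)` is close to the centre of a lattice box inside `Λ_L(x)`: shrink towards
`x` and round. -/
theorem exists_lat_near {a L : ℝ} (ha : 0 < a) (haL : 2 * a ≤ L) {x y : Space d}
    (hy : y ∈ box L x) :
    ∃ k, box a (lat a x k) ⊆ box L x ∧ ∀ i, |y i - lat a x k i| ≤ 3 / 2 * a := by
  have hL : 0 < L := by linarith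
  -- the factor `1 - 2 a / L` makes room for the rounding error `a / 2` and the half side `a / 2`
  set r : Fin d → ℝ := fun i => (y i - x i) * (1 - 2 * a / L) / a with hr
  have hround : ∀ i, |r i - round (r i)| ≤ 1 / 2 := fun i => abs_sub_round (r i)
  have hfac : 0 ≤ 1 - 2 * a / L := by
    rw [sub_nonneg, div_le_one hL]; exact haL
  refine ⟨fun i => round (r i), box_subset_box fun i => ?_, fun i => ?_⟩
  · have h1 : |a * r i| ≤ L / 2 - a := by
      have e : a * r i = (y i - x i) * (1 - 2 * a / L) := by
        simp only [hr]; field_simp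
      rw [e, abs_mul, abs_of_nonneg hfac]
      calc |y i - x i| * (1 - 2 * a / L) ≤ L / 2 * (1 - 2 * a / L) := by
            gcongr; exact (hy i).le
        _ = L / 2 - a := by field_simp
    have h2 : |a * (r i - round (r i))| ≤ a / 2 := by
      rw [abs_mul, abs_of_pos ha]
      nlinarith [hround i]
    have e : lat a x (fun i => round (r i)) i - x i = a * r i - a * (r i - round (r i)) := by
      simp only [lat_apply]; ring
    rw [e]
    have := abs_sub (a * r i) (a * (r i - round (r i)))
    linarith
  · have h1 : |(y i - x i) * (2 * a / L)| ≤ a := by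
      rw [abs_mul, abs_of_pos (show 0 < 2 * a / L by positivity)]
      calc |y i - x i| * (2 * a / L) ≤ L / 2 * (2 * a / L) := by
            gcongr; exact (hy i).le
        _ = a := by field_simp
    have h2 : |a * (r i - round (r i))| ≤ a / 2 := by
      rw [abs_mul, abs_of_pos ha]
      nlinarith [hround i]
    have e : y i - lat a x (fun i => round (r i)) i
        = (y i - x i) * (2 * a / L) + a * (r i - round (r i)) := by
      simp only [lat_apply, hr]
      field_simp
      ring
    rw [e]
    have := abs_add_le ((y i - x i) * (2 * a / L)) (a * (r i - round (r i)))
    linarith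

/-- A box of side `ℓ` contains at least `(ℓ/a - 2)^d` lattice boxes of side `a`. -/
theorem exists_finset_lat {a ℓ : ℝ} (ha : 0 < a) (haℓ : 2 * a ≤ ℓ) (x z : Space d) :
    ∃ F : Finset (Fin d → ℤ), (∀ k ∈ F, box a (lat a x k) ⊆ box ℓ z) ∧
      (ℓ / a - 2) ^ d ≤ (F.card : ℝ) := by
  set lo : Fin d → ℤ := fun i => ⌈(z i - x i - ℓ / 2) / a + 1 / 2⌉ with hlo
  set hi : Fin d → ℤ := fun i => ⌊(z i - x i + ℓ / 2) / a - 1 / 2⌋ with hhi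
  refine ⟨Fintype.piFinset fun i => Finset.Icc (lo i) (hi i), fun k hk => ?_, ?_⟩
  · refine box_subset_box fun i => ?_
    have h := Finset.mem_Icc.1 (Fintype.mem_piFinset.1 hk i)
    have h1 : (z i - x i - ℓ / 2) / a + 1 / 2 ≤ k i := Int.ceil_le.1 h.1
    have h2 : (k i : ℝ) ≤ (z i - x i + ℓ / 2) / a - 1 / 2 := Int.le_floor.1 h.2
    have h1' : (z i - x i - ℓ / 2) / a ≤ k i - 1 / 2 := by linarith
    have h2' : (k i : ℝ) + 1 / 2 ≤ (z i - x i + ℓ / 2) / a := by linarith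
    rw [div_le_iff₀ ha] at h1'
    rw [le_div_iff₀ ha] at h2'
    have : |lat a x k i - z i| ≤ ℓ / 2 - a / 2 := by
      rw [abs_le, lat_apply]
      constructor <;> linarith
    linarith
  · rw [Fintype.card_piFinset]
    push_cast
    have h0 : (ℓ / a - 2) ^ d = ∏ _i : Fin d, (ℓ / a - 2) := by simp
    have h2a : 2 ≤ ℓ / a := (le_div_iff₀ ha).2 haℓ
    rw [h0]
    refine Finset.prod_le_prod (fun i _ => by linarith) fun i _ => ?_
    rw [Int.card_Icc]
    have h1 : (lo i : ℝ) < (z i - x i - ℓ / 2) / a + 1 / 2 + 1 := Int.ceil_lt_add_one _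
    have h2 : (z i - x i + ℓ / 2) / a - 1 / 2 < (hi i : ℝ) + 1 := Int.lt_floor_add_one _
    have h3 : (z i - x i + ℓ / 2) / a - (z i - x i - ℓ / 2) / a = ℓ / a := by ring
    have h4 : ((hi i + 1 - lo i : ℤ) : ℝ) ≤ (((hi i + 1 - lo i).toNat : ℤ) : ℝ) := by
      exact_mod_cast Int.self_le_toNat _
    rw [Int.cast_natCast] at h4
    push_cast at h4
    linarith

theorem finite_lat_subset {a : ℝ} (ha : 0 < a) (L : ℝ) (x : Space d) :
    {k : Fin d → ℤ | box a (lat a x k) ⊆ box L x}.Finite := by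
  refine (Set.Finite.pi (t := fun _ : Fin d => Set.Icc (-⌈L / a⌉) ⌈L / a⌉)
    fun _ => Set.finite_Icc _ _).subset fun k hk => ?_
  rw [mem_univ_pi]
  intro i
  have h := hk (self_mem_box ha _) i
  rw [lat_apply, add_sub_cancel_left, abs_mul, abs_of_pos ha] at h
  have hL : 0 < L := by
    have := mul_nonneg ha.le (abs_nonneg (k i : ℝ))
    linarith
  have h1 : |(k i : ℝ)| ≤ L / a := by
    rw [le_div_iff₀ ha]; linarith
  have h2 : |(k i : ℝ)| ≤ ⌈L / a⌉ := h1.trans (Int.le_ceil _)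
  have h3 : |k i| ≤ ⌈L / a⌉ := by exact_mod_cast h2
  exact abs_le.1 h3

/-- At most `(L/a)^d` lattice boxes of side `a` fit into a box of side `L`. -/
theorem card_lat_le {a L : ℝ} (ha : 0 < a) (hL : 0 ≤ L) (x : Space d) (F : Finset (Fin d → ℤ))
    (hF : ∀ k ∈ F, box a (lat a x k) ⊆ box L x) : (F.card : ℝ) ≤ (L / a) ^ d := by
  have h1 : volume (⋃ k ∈ F, box a (lat a x k)) = F.card * ENNReal.ofReal a ^ d := by
    rw [measure_biUnion_finset]
    · simp [volume_box]
    · intro k _ k' _ hkk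
      rw [Function.onFun, Set.disjoint_left]
      exact fun y h h' => hkk (eq_of_mem_box_lat ha h h')
    · exact fun k _ => measurableSet_box _ _
  have h2 : volume (⋃ k ∈ F, box a (lat a x k)) ≤ volume (box L x) :=
    measure_mono (iUnion₂_subset hF)
  rw [h1, volume_box, ← ENNReal.ofReal_pow ha.le, ← ENNReal.ofReal_pow hL,
    ← ENNReal.ofReal_natCast, ← ENNReal.ofReal_mul (by positivity),
    ENNReal.ofReal_le_ofReal_iff (by positivity)] at h2
  rw [div_pow, le_div_iff₀ (by positivity)]
  exact h2

/-! ### Sites -/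

theorem eta_pos (d : ℕ) (L : ℝ) : 0 < eta d L := Real.exp_pos _

theorem mem_sites_iff {L : ℝ} {x j : Space d} :
    j ∈ sites L x ↔ ∃ k, box (eta d L) (lat (eta d L) x k) ⊆ box L x ∧ lat (eta d L) x k = j := by
  constructor
  · rintro ⟨⟨k, hk⟩, hj⟩
    have : lat (eta d L) x k = j := by
      ext i; rw [lat_apply, hk]
    exact ⟨k, this ▸ hj, this⟩
  · rintro ⟨k, hk, rfl⟩
    exact ⟨⟨k, fun i => rfl⟩, hk⟩

theorem finite_sites (L : ℝ) (x : Space d) : (sites L x).Finite := by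
  refine ((finite_lat_subset (eta_pos d L) L x).image (lat (eta d L) x)).subset ?_
  intro j hj
  exact mem_sites_iff.1 hj

theorem sites_subset_box {L : ℝ} {x j : Space d} (hj : j ∈ sites L x) : j ∈ box L x :=
  hj.2 (self_mem_box (eta_pos d L) j)

theorem site_unique {L : ℝ} {x j j' y : Space d} (hj : j ∈ sites L x) (hj' : j' ∈ sites L x)
    (h : y ∈ box (eta d L) j) (h' : y ∈ box (eta d L) j') : j = j' := by
  obtain ⟨k, -, rfl⟩ := mem_sites_iff.1 hj
  obtain ⟨k', -, rfl⟩ := mem_sites_iff.1 hj'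
  rw [eq_of_mem_box_lat (eta_pos d L) h h']

end Boxes

/-! ### Good boxes -/

section Good

theorem EssBounded.add {α : Type*} [MeasurableSpace α] {μ : Measure α} {a b : α → ℝ}
    (ha : EssBounded μ a) (hb : EssBounded μ b) : EssBounded μ (fun y => a y + b y) := by
  obtain ⟨h1, c, hc⟩ := ha
  obtain ⟨h2, c', hc'⟩ := hb
  refine ⟨h1.add h2, c + c', ?_⟩
  filter_upwards [hc, hc'] with y hy hy'
  exact (abs_add_le _ _).trans (add_le_add hy hy')

theorem EssBounded.sum {α ι : Type*} [MeasurableSpace α] {μ : Measure α} (X : Finset ι)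
    {a : ι → α → ℝ} (ha : ∀ i ∈ X, EssBounded μ (a i)) : EssBounded μ (fun y => ∑ i ∈ X, a i y) := by
  classical
  induction X using Finset.induction_on with
  | empty => exact ⟨by simpa using aestronglyMeasurable_const, 0, by simp⟩
  | insert i X hi ih =>
    simp only [Finset.sum_insert hi]
    exact (ha i (Finset.mem_insert_self _ _)).add
      (ih fun j hj => ha j (Finset.mem_insert_of_mem hj))

variable {d : ℕ}

theorem ae_translate {p : Space d → Prop} (h : ∀ᵐ y : Space d, p y) (ζ : Space d) :
    ∀ᵐ y : Space d, p (y - ζ) :=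
  (measurePreserving_sub_right volume ζ).quasiMeasurePreserving.ae h

/-- If the potential created by `B` alone is at least `2 E₀ + 1` on the box, then the box is good
for every free configuration `S` and all energies up to `E₀`. -/
theorem isGoodBox_of_cover {u : Space d → ℝ} {um up δm δp : ℝ} (hum : 0 < um) (hup : 0 < up)
    (hu : AEStronglyMeasurable u volume)
    (hu_lower : ∀ᵐ y : Space d, (box δm (0 : Space d)).indicator (fun _ => um) y ≤ u y)
    (hu_upper : ∀ᵐ y : Space d, u y ≤ (box δp (0 : Space d)).indicator (fun _ => up) y)
    (κ : ℝ) {L E E₀ : ℝ} (hE : E ∈ Icc 0 E₀) (hL : 20 * d ≤ L) (x : Space d)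
    (B S : Finset (Space d)) (hBS : Disjoint B S) (hB : ∀ ζ ∈ B, ζ ∈ box L x) (N : ℕ)
    (hN : 2 * E₀ + 1 ≤ N * um)
    (hcover : ∀ y ∈ box L x, N ≤ ((B : Set (Space d)) ∩ box δm y).ncard) :
    IsGoodBox u κ L x E (Real.sqrt E₀ / 2) B S := by
  classical
  refine ⟨hBS, fun t ht => ?_⟩
  have hE₀ : 0 ≤ E₀ := hE.1.trans hE.2
  have hu0 : ∀ᵐ y : Space d, 0 ≤ u y := by
    filter_upwards [hu_lower] with y hy
    exact (indicator_nonneg (fun _ _ => hum.le) y).trans hy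
  have hterm : ∀ (c : ℝ) (ζ : Space d),
      EssBounded (volume.restrict (box L x)) (fun y => c * u (y - ζ)) := by
    intro c ζ
    refine ⟨((hu.comp_quasiMeasurePreserving
      (measurePreserving_sub_right volume ζ).quasiMeasurePreserving).const_mul c).restrict,
      |c| * up, ae_restrict_of_ae ?_⟩
    filter_upwards [ae_translate hu0 ζ, ae_translate hu_upper ζ] with y h0 h1
    rw [abs_mul, abs_of_nonneg h0]
    gcongr
    refine h1.trans (indicator_le_self' (fun _ _ => hup.le) _)
  have hterm' : ∀ (c : Space d → ℝ) (ζ : Space d), EssBounded (volume.restrict (box L x))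
      (fun y => (box L x).indicator (fun ζ => c ζ * u (y - ζ)) ζ) := by
    intro c ζ
    by_cases hζ : ζ ∈ box L x
    · simpa only [indicator_of_mem hζ] using hterm (c ζ) ζ
    · simpa only [indicator_of_notMem hζ, zero_mul] using hterm 0 ζ
  have hpot : EssBounded (volume.restrict (box L x)) (potential u (box L x) B S t) := by
    refine EssBounded.add (EssBounded.sum B fun ζ _ => ?_) (EssBounded.sum S fun ζ _ => hterm' t ζ)
    simpa using hterm' (fun _ => 1) ζ
  have ha : EssBounded (volume.restrict (box L x))
      (fun y => potential u (box L x) B S t y - E) :=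
    hpot.add (b := fun _ => -E) ⟨aestronglyMeasurable_const, |-E|, by simp⟩
  have hlow : ∀ᵐ y ∂(volume : Measure (Space d)).restrict (box L x),
      2 * E₀ + 1 ≤ potential u (box L x) B S t y := by
    have hBt : ∀ᵐ y : Space d, ∀ ζ ∈ B,
        (box δm (0 : Space d)).indicator (fun _ => um) (y - ζ) ≤ u (y - ζ) :=
      (Finset.eventually_all B).2 fun ζ _ => ae_translate hu_lower ζ
    have hSt : ∀ᵐ y : Space d, ∀ ζ ∈ S, 0 ≤ u (y - ζ) :=
      (Finset.eventually_all S).2 fun ζ _ => ae_translate hu0 ζ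
    rw [ae_restrict_iff' (measurableSet_box L x)]
    filter_upwards [hBt, hSt] with y h1 h2 hy
    have e1 : (N : ℝ) * um ≤ ∑ ζ ∈ B, (box L x).indicator (fun ζ => u (y - ζ)) ζ := by
      have e2 : ∑ ζ ∈ B, (if ζ ∈ box δm y then um else 0)
          ≤ ∑ ζ ∈ B, (box L x).indicator (fun ζ => u (y - ζ)) ζ := by
        refine Finset.sum_le_sum fun ζ hζ => ?_
        rw [indicator_of_mem (hB ζ hζ)]
        refine le_trans (le_of_eq ?_) (h1 ζ hζ)
        have : ζ ∈ box δm y ↔ y - ζ ∈ box δm (0 : Space d) := by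
          rw [mem_box_comm]; simp [box]
        by_cases hc : ζ ∈ box δm y
        · rw [if_pos hc, indicator_of_mem (this.1 hc)]
        · rw [if_neg hc, indicator_of_notMem (fun h => hc (this.2 h))]
      refine le_trans ?_ e2
      rw [← Finset.sum_filter, Finset.sum_const, nsmul_eq_mul]
      have e3 := hcover y hy
      have e4 : (B : Set (Space d)) ∩ box δm y = ((B.filter fun ζ => ζ ∈ box δm y : Finset _) : Set _) := by
        ext ζ; simp
      rw [e4, Set.ncard_coe_finset] at e3
      gcongr
    have e2 : 0 ≤ ∑ ζ ∈ S, (box L x).indicator (fun ζ => t ζ * u (y - ζ)) ζ := by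
      refine Finset.sum_nonneg fun ζ hζ => ?_
      by_cases hc : ζ ∈ box L x
      · rw [indicator_of_mem hc]; exact mul_nonneg (ht ζ hζ).1 (h2 ζ hζ)
      · rw [indicator_of_notMem hc]
    rw [potential]
    linarith
  obtain ⟨R, hR, hR1, hRw⟩ := exists_isResolvent (potential u (box L x) B S t) E ha (by
    filter_upwards [hlow] with y hy
    linarith [hE.2])
  refine ⟨R, hR, hR1.trans (Real.one_le_exp ?_), fun y _ z _ hyz => ?_⟩
  · have : 0 ≤ L := le_trans (by positivity) hL
    positivity
  · refine (norm_chi_comp_chi_le (isBounded_box L x) (measurableSet_box L x) _ ha (Real.sqrt E₀)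
      (Real.sqrt_nonneg _) ?_ R hRw y z).trans (Real.exp_le_exp.2 ?_)
    · filter_upwards [hlow] with y hy
      rw [Real.sq_sqrt hE₀]
      linarith [hE.2]
    · have h1 : 2 * (d : ℝ) ≤ ‖y - z‖ := by linarith
      nlinarith [Real.sqrt_nonneg E₀]

end Good

/-! ### Poisson tail estimates -/

section Poisson

variable {Ω S : Type*} [MeasurableSpace Ω] [MeasurableSpace S] {P : Measure Ω}
  {μ : Measure S} {Z : Ω → Set S}

theorem IsPoissonProcess.real_lt [IsProbabilityMeasure P] (h : IsPoissonProcess P μ Z) {A : Set S}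
    (hA : MeasurableSet A) (hfin : μ A < ∞) (n : ℕ) :
    P.real {ω | (Z ω ∩ A).encard < n} =
      ∑ k ∈ Finset.range n, μ.real A ^ k / (k.factorial : ℝ) * Real.exp (-μ.real A) := by
  have e : {ω | (Z ω ∩ A).encard < n} = ⋃ k ∈ Finset.range n, {ω | (Z ω ∩ A).encard = k} := by
    ext ω
    simp only [mem_ofPred_eq, mem_iUnion, Finset.mem_range, exists_prop]
    constructor
    · intro hlt
      obtain ⟨m, hm⟩ := ENat.ne_top_iff_exists.1 (ne_top_of_lt hlt)
      rw [← hm] at hlt ⊢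
      exact ⟨m, by exact_mod_cast hlt, rfl⟩
    · rintro ⟨k, hk, hk'⟩
      rw [hk']
      exact_mod_cast hk
  rw [e, measureReal_biUnion_finset]
  · refine Finset.sum_congr rfl fun k _ => ?_
    rw [Measure.real, h.law A hA hfin k, ENNReal.toReal_ofReal (by positivity)]
    rfl
  · intro k _ k' _ hkk
    rw [Function.onFun, Set.disjoint_left]
    intro ω h1 h2
    simp only [mem_ofPred_eq] at h1 h2
    rw [h1] at h2
    exact hkk (by exact_mod_cast h2)
  · exact fun k _ => h.measurable A hA (measurableSet_singleton _)

theorem IsPoissonProcess.measurableSet_lt (h : IsPoissonProcess P μ Z) {A : Set S}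
    (hA : MeasurableSet A) (n : ℕ) : MeasurableSet {ω | (Z ω ∩ A).encard < n} :=
  h.measurable A hA (MeasurableSet.of_discrete (s := Iio (n : ℕ∞)))

theorem IsPoissonProcess.real_ge [IsProbabilityMeasure P] (h : IsPoissonProcess P μ Z) {A : Set S}
    (hA : MeasurableSet A) (hfin : μ A < ∞) (n : ℕ) :
    P.real {ω | (n : ℕ∞) ≤ (Z ω ∩ A).encard} =
      1 - ∑ k ∈ Finset.range n, μ.real A ^ k / (k.factorial : ℝ) * Real.exp (-μ.real A) := by
  rw [← h.real_lt hA hfin, ← probReal_compl_eq_one_sub (h.measurableSet_lt hA n)]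
  congr 1
  ext ω
  simp

/-- Lower tail of the Poisson distribution. -/
theorem IsPoissonProcess.real_lt_le [IsProbabilityMeasure P] (h : IsPoissonProcess P μ Z)
    {A : Set S} (hA : MeasurableSet A) (hfin : μ A < ∞) (n : ℕ) :
    P.real {ω | (Z ω ∩ A).encard < n} ≤ 2 ^ n * Real.exp (-(μ.real A / 2)) := by
  rw [h.real_lt hA hfin, ← Finset.sum_mul]
  set t := μ.real A
  have ht : 0 ≤ t := measureReal_nonneg
  have h1 : ∑ k ∈ Finset.range n, t ^ k / (k.factorial : ℝ) ≤ 2 ^ n * Real.exp (t / 2) := by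
    have h2 : ∑ k ∈ Finset.range n, t ^ k / (k.factorial : ℝ)
        ≤ ∑ k ∈ Finset.range n, 2 ^ n * ((t / 2) ^ k / (k.factorial : ℝ)) := by
      refine Finset.sum_le_sum fun k hk => ?_
      have h3 : t ^ k = 2 ^ k * (t / 2) ^ k := by rw [← mul_pow]; congr 1; ring
      rw [h3, mul_div_assoc]
      have h4 : (2 : ℝ) ^ k ≤ 2 ^ n :=
        pow_le_pow_right₀ one_le_two (Finset.mem_range.1 hk).le
      gcongr
    rw [← Finset.mul_sum] at h2
    refine h2.trans ?_
    gcongr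
    exact Real.sum_le_exp_of_nonneg (by positivity) n
  calc _ ≤ 2 ^ n * Real.exp (t / 2) * Real.exp (-t) := by gcongr
    _ = 2 ^ n * Real.exp (-(t / 2)) := by
      rw [mul_assoc, ← Real.exp_add]; congr 2; ring

theorem IsPoissonProcess.real_one_le [IsProbabilityMeasure P] (h : IsPoissonProcess P μ Z)
    {A : Set S} (hA : MeasurableSet A) (hfin : μ A < ∞) :
    P.real {ω | ((1 : ℕ) : ℕ∞) ≤ (Z ω ∩ A).encard} ≤ μ.real A := by
  rw [h.real_ge hA hfin]
  have := Real.add_one_le_exp (-μ.real A)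
  simp
  linarith

theorem IsPoissonProcess.real_two_le [IsProbabilityMeasure P] (h : IsPoissonProcess P μ Z)
    {A : Set S} (hA : MeasurableSet A) (hfin : μ A < ∞) :
    P.real {ω | ((2 : ℕ) : ℕ∞) ≤ (Z ω ∩ A).encard} ≤ μ.real A ^ 2 := by
  rw [h.real_ge hA hfin]
  have h1 := Real.add_one_le_exp (-μ.real A)
  have h2 : 0 ≤ μ.real A := measureReal_nonneg
  simp [Finset.sum_range_succ]
  nlinarith

/-- Upper tail of the Poisson distribution (Chernoff bound). -/
theorem IsPoissonProcess.real_ge_le [IsProbabilityMeasure P] (h : IsPoissonProcess P μ Z)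
    {A : Set S} (hA : MeasurableSet A) (hfin : μ A < ∞) (n : ℕ) :
    P.real {ω | (n : ℕ∞) ≤ (Z ω ∩ A).encard}
      ≤ Real.exp ((Real.exp 1 - 1) * μ.real A - n) := by
  rw [h.real_ge hA hfin, ← Finset.sum_mul]
  set t := μ.real A
  have ht : 0 ≤ t := measureReal_nonneg
  have hexp : ∀ s : ℝ, HasSum (fun k : ℕ => s ^ k / (k.factorial : ℝ)) (Real.exp s) := by
    intro s
    rw [Real.exp_eq_exp_ℝ]
    exact NormedSpace.expSeries_div_hasSum_exp s
  have h1 : HasSum (fun k : ℕ => if k < n then t ^ k / (k.factorial : ℝ) else 0)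
      (∑ k ∈ Finset.range n, t ^ k / (k.factorial : ℝ)) := by
    have h2 := hasSum_sum_of_ne_finset_zero (L := SummationFilter.unconditional ℕ)
      (f := fun k : ℕ => if k < n then t ^ k / (k.factorial : ℝ) else 0) (s := Finset.range n)
      (fun k hk => if_neg (fun hlt => hk (Finset.mem_range.2 hlt)))
    convert h2 using 1
    exact Finset.sum_congr rfl fun k hk => (if_pos (Finset.mem_range.1 hk)).symm
  have h2 := h1.add ((hexp (Real.exp 1 * t)).mul_left (Real.exp (-n)))
  have h3 := hasSum_le (fun k => ?_) (hexp t) h2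
  · have h4 : Real.exp ((Real.exp 1 - 1) * t - n)
        = Real.exp (-n) * Real.exp (Real.exp 1 * t) * Real.exp (-t) := by
      rw [← Real.exp_add, ← Real.exp_add]; congr 1; ring
    rw [h4]
    have h5 : Real.exp t * Real.exp (-t) = 1 := by rw [← Real.exp_add]; simp
    have h6 := mul_le_mul_of_nonneg_right h3 (Real.exp_pos (-t)).le
    rw [h5, add_mul] at h6
    linarith
  · have h7 : 0 ≤ t ^ k / (k.factorial : ℝ) := by positivity
    by_cases hk : k < n
    · rw [if_pos hk]
      exact le_add_of_nonneg_right (by positivity)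
    · rw [if_neg hk, zero_add, mul_pow, mul_div_assoc, ← mul_assoc, ← Real.exp_nat_mul,
        ← Real.exp_add]
      refine le_mul_of_one_le_left h7 (Real.one_le_exp ?_)
      have : (n : ℝ) ≤ k := by exact_mod_cast not_lt.1 hk
      linarith

/-- Transfer of a Poisson process along a correspondence of measurable sets which preserves
intensities and numbers of points. -/
theorem IsPoissonProcess.transfer {S' : Type*} [MeasurableSpace S'] {μ' : Measure S'}
    {Z' : Ω → Set S'} (h : IsPoissonProcess P μ Z) (T : Set S' → Set S)
    (hT : ∀ A, MeasurableSet A → MeasurableSet (T A))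
    (hd : ∀ A B, Disjoint A B → Disjoint (T A) (T B))
    (hμ : ∀ A, MeasurableSet A → μ (T A) = μ' A)
    (hc : ∀ ω, (Z' ω).Countable)
    (hcount : ∀ ω A, (Z' ω ∩ A).encard = (Z ω ∩ T A).encard) :
    IsPoissonProcess P μ' Z' where
  countable := hc
  measurable A hA := by simpa only [hcount] using h.measurable _ (hT A hA)
  law A hA hfin k := by
    rw [← hμ A hA] at hfin ⊢
    simpa only [hcount] using h.law _ (hT A hA) hfin k
  indep n A hA hdis := by
    simpa only [hcount] using h.indep n (fun j => T (A j)) (fun j => hT _ (hA j))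
      (fun i j hij => hd _ _ (hdis hij))

end Poisson

section Marked

variable {d : ℕ} {Ω : Type*} [MeasurableSpace Ω] {P : Measure Ω} {ϱ : ℝ}
  {Y : Ω → Set (Space d)} {ε : Ω → Space d → Bool}

theorem markedVolume_apply {A : Set (Space d × Bool)} (hA : MeasurableSet A) :
    markedVolume d A = (2 : ℝ≥0∞)⁻¹ * (volume {x : Space d | (x, false) ∈ A}
      + volume {x : Space d | (x, true) ∈ A}) := by
  rw [markedVolume, Measure.smul_apply, Measure.add_apply,
    Measure.map_apply measurable_prodMk_right hA, Measure.map_apply measurable_prodMk_right hA]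
  rfl

theorem IsMarkedPoisson.countable (h : IsMarkedPoisson P ϱ Y ε) (ω : Ω) : (Y ω).Countable := by
  refine ((IsPoissonProcess.countable h ω).image Prod.fst).mono fun y hy => ?_
  exact ⟨(y, ε ω y), ⟨hy, rfl⟩, rfl⟩

/-- The unmarked points form a Poisson process of density `2ϱ`. -/
theorem IsMarkedPoisson.poisson (h : IsMarkedPoisson P ϱ Y ε) :
    IsPoissonProcess P (ENNReal.ofReal (2 * ϱ) • (volume : Measure (Space d))) Y := by
  refine IsPoissonProcess.transfer h (fun A => Prod.fst ⁻¹' A) (fun A hA => measurable_fst hA)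
    (fun A B hAB => hAB.preimage _) (fun A hA => ?_) h.countable fun ω A => ?_
  · rw [Measure.smul_apply, Measure.smul_apply, markedVolume_apply (measurable_fst hA)]
    simp only [mem_preimage, ofPred_mem_eq]
    rw [← two_mul, ← mul_assoc, ENNReal.inv_mul_cancel (by simp) (by simp), one_mul]
  · have e : Y ω ∩ A = Prod.fst '' (markedConfig (Y ω) (ε ω) ∩ Prod.fst ⁻¹' A) := by
      ext y
      simp [markedConfig]
    rw [e, InjOn.encard_image]
    rintro ⟨y, b⟩ ⟨⟨-, h1⟩, -⟩ ⟨y', b'⟩ ⟨⟨-, h2⟩, -⟩ rfl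
    exact Prod.ext rfl (h1.trans h2.symm)

/-- The points with mark `1` form a Poisson process of density `ϱ`. -/
theorem IsMarkedPoisson.poisson_marked (h : IsMarkedPoisson P ϱ Y ε) :
    IsPoissonProcess P (ENNReal.ofReal ϱ • (volume : Measure (Space d))) (marked Y ε true) := by
  have hm : ∀ A : Set (Space d), MeasurableSet A → MeasurableSet (A ×ˢ ({true} : Set Bool)) :=
    fun A hA => hA.prod (measurableSet_singleton _)
  refine IsPoissonProcess.transfer h (fun A => A ×ˢ {true}) hm
    (fun A B hAB => Disjoint.set_prod_left hAB _ _) (fun A hA => ?_)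
    (fun ω => (h.countable ω).mono fun y hy => hy.1) fun ω A => ?_
  · rw [Measure.smul_apply, Measure.smul_apply, markedVolume_apply (hm A hA)]
    simp only [mem_prod, mem_singleton_iff, Bool.false_eq_true, and_false, and_true,
      ofPred_mem_eq, ofPred_false, measure_empty, zero_add, smul_eq_mul]
    rw [← mul_assoc, ENNReal.ofReal_mul zero_le_two, ENNReal.ofReal_ofNat,
      mul_comm (2 : ℝ≥0∞), mul_assoc (ENNReal.ofReal ϱ),
      ENNReal.mul_inv_cancel (by simp) (by simp), mul_one]
  · have e : marked Y ε true ω ∩ A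
        = Prod.fst '' (markedConfig (Y ω) (ε ω) ∩ A ×ˢ ({true} : Set Bool)) := by
      ext y
      simp only [marked, markedConfig, mem_inter_iff, mem_ofPred_eq, mem_image, mem_prod,
        mem_singleton_iff]
      constructor
      · rintro ⟨⟨h1, h2⟩, h3⟩
        exact ⟨(y, true), ⟨⟨h1, h2.symm⟩, h3, rfl⟩, rfl⟩
      · rintro ⟨⟨y', b⟩, ⟨⟨h1, h2⟩, h3, h4⟩, rfl⟩
        exact ⟨⟨h1, h2.symm.trans h4⟩, h3⟩
    rw [e, InjOn.encard_image]
    rintro ⟨y, b⟩ ⟨⟨-, h1⟩, -⟩ ⟨y', b'⟩ ⟨⟨-, h2⟩, -⟩ rfl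
    exact Prod.ext rfl (h1.trans h2.symm)

end Marked

/-! ### Sites of a configuration -/

section Sites

variable {d : ℕ} {ϱ L : ℝ} {x : Space d}

/-- The sites whose boxes contain a point of `Z`. -/
def siteSet (L : ℝ) (x : Space d) (Z : Set (Space d)) : Set (Space d) :=
  {j | j ∈ sites L x ∧ (Z ∩ box (eta d L) j).Nonempty}

theorem siteSet_subset (Z : Set (Space d)) : siteSet L x Z ⊆ sites L x := fun _ h => h.1

theorem finite_siteSet (Z : Set (Space d)) : (siteSet L x Z).Finite :=
  (finite_sites L x).subset (siteSet_subset Z)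

theorem siteSet_union (Z Z' : Set (Space d)) :
    siteSet L x (Z ∪ Z') = siteSet L x Z ∪ siteSet L x Z' := by
  ext j
  simp only [siteSet, mem_ofPred_eq, mem_union, union_inter_distrib_right, union_nonempty]
  tauto

theorem inter_box_of_subset_sites {Q : Set (Space d)} (hQ : Q ⊆ sites L x) {j : Space d}
    (hj : j ∈ sites L x) : Q ∩ box (eta d L) j = {j' | j' = j ∧ j ∈ Q} := by
  ext j'
  constructor
  · rintro ⟨h1, h2⟩
    have : j' = j := site_unique (hQ h1) hj (self_mem_box (eta_pos d L) j') h2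
    exact ⟨this, this ▸ h1⟩
  · rintro ⟨rfl, h⟩
    exact ⟨h, self_mem_box (eta_pos d L) j'⟩

theorem siteSet_of_subset_sites {Q : Set (Space d)} (hQ : Q ⊆ sites L x) :
    siteSet L x Q = Q := by
  ext j
  constructor
  · rintro ⟨h1, h2⟩
    rw [inter_box_of_subset_sites hQ h1] at h2
    obtain ⟨j', -, h⟩ := h2
    exact h
  · intro h
    exact ⟨hQ h, j, h, self_mem_box (eta_pos d L) j⟩

theorem siteSet_eq_of_mem_cls {Q Z : Set (Space d)} (hQ : Q ⊆ sites L x)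
    (h : Z ∈ cls ϱ L x Q) : siteSet L x Z = Q := by
  rw [← siteSet_of_subset_sites hQ]
  ext j
  simp only [siteSet, mem_ofPred_eq, and_congr_right_iff]
  intro hj
  rw [← encard_ne_zero, ← encard_ne_zero, h.2 j hj]

theorem mem_cls_siteSet {Z : Set (Space d)} (h : IsAcceptable ϱ L x Z) :
    Z ∈ cls ϱ L x (siteSet L x Z) := by
  refine ⟨h, fun j hj => ?_⟩
  rw [inter_box_of_subset_sites (siteSet_subset Z) hj]
  by_cases hne : (Z ∩ box (eta d L) j).Nonempty
  · have e : {j' | j' = j ∧ j ∈ siteSet L x Z} = {j} := by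
      ext j'
      simp only [mem_ofPred_eq, mem_singleton_iff, and_iff_left_iff_imp]
      exact fun _ => ⟨hj, hne⟩
    rw [e, encard_singleton]
    exact le_antisymm (h.2.2.1 j hj) (one_le_encard_iff_nonempty.2 hne)
  · have e : {j' | j' = j ∧ j ∈ siteSet L x Z} = ∅ :=
      eq_empty_of_forall_notMem fun j' hj' => hne hj'.2.2
    rw [e, encard_empty, encard_eq_zero]
    exact not_nonempty_iff_eq_empty.1 hne

theorem IsAcceptable.mono {Z Z' : Set (Space d)} (h : IsAcceptable ϱ L x Z) (hZ : Z' ⊆ Z) :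
    IsAcceptable ϱ L x Z' := by
  obtain ⟨h1, ⟨h2, h3⟩, h4, h5⟩ := h
  refine ⟨h1.mono hZ, ⟨h2.subset (inter_subset_inter_left _ hZ), ?_⟩, fun j hj => ?_, ?_⟩
  · refine lt_of_le_of_lt ?_ h3
    exact_mod_cast ncard_le_ncard (inter_subset_inter_left _ hZ) h2
  · exact (encard_le_encard (inter_subset_inter_left _ hZ)).trans (h4 j hj)
  · exact subset_empty_iff.1 (h5 ▸ inter_subset_inter_left _ hZ)

theorem ncard_siteSet_lt {Z : Set (Space d)} (h : IsAcceptable ϱ L x Z) :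
    ((siteSet L x Z).ncard : ℝ) < 16 * ϱ * L ^ d := by
  refine lt_of_le_of_lt ?_ h.2.1.2
  have hp : ∀ j : Space d, j ∈ siteSet L x Z → ∃ p, p ∈ Z ∩ box (eta d L) j := fun j hj => hj.2
  choose! p hp using hp
  refine Nat.cast_le.2 (ncard_le_ncard_of_injOn p
    (fun j hj => ⟨(hp j hj).1, hj.1.2 (hp j hj).2⟩)
    (fun j hj j' hj' he => site_unique hj.1 hj'.1 (hp j hj).2 (he ▸ (hp j' hj').2))
    h.2.1.1)

theorem IsAcceptable.exists_site {Z : Set (Space d)} (h : IsAcceptable ϱ L x Z) {p : Space d}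
    (hp : p ∈ Z) (hpL : p ∈ box L x) : ∃ j ∈ sites L x, p ∈ box (eta d L) j := by
  by_contra! hc
  have : p ∈ (∅ : Set (Space d)) := by
    rw [← h.2.2.2]
    refine ⟨hp, hpL, ?_⟩
    simp only [mem_iUnion, not_exists]
    intro j hj hpj
    refine hc j hj fun i => (hpj i).trans_le ?_
    have := eta_pos d L
    nlinarith
  exact this

/-- An acceptable configuration has as many sites in a region as it has points deeper inside. -/
theorem IsAcceptable.encard_le_encard_siteSet {Y Z A A' : Set (Space d)}
    (h : IsAcceptable ϱ L x Y) (hZ : Z ⊆ Y) (hA : A ⊆ box L x)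
    (hAA' : ∀ p ∈ A, ∀ j, p ∈ box (eta d L) j → j ∈ A') :
    (Z ∩ A).encard ≤ (siteSet L x Z ∩ A').encard := by
  have hs : ∀ p : Space d, p ∈ Z ∩ A → ∃ j ∈ sites L x, p ∈ box (eta d L) j :=
    fun p hp => h.exists_site (hZ hp.1) (hA hp.2)
  choose! s hs1 hs2 using hs
  refine encard_le_encard_of_injOn (f := s)
    (fun p hp => ⟨⟨hs1 p hp, p, hp.1, hs2 p hp⟩, hAA' p hp.2 _ (hs2 p hp)⟩) ?_
  intro p hp p' hp' he
  exact encard_le_one_iff.1 (h.2.2.1 (s p) (hs1 p hp)) p p' ⟨hZ hp.1, hs2 p hp⟩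
    ⟨hZ hp'.1, he ▸ hs2 p' hp'⟩

end Sites

/-! ### Localized events with free sites in a fixed region -/

section Localized

variable {d : ℕ} {Ω : Type*}

theorem marked_union (Y : Ω → Set (Space d)) (ε : Ω → Space d → Bool) (ω : Ω) :
    marked Y ε true ω ∪ marked Y ε false ω = Y ω := by
  ext y
  simp only [marked, mem_union, mem_ofPred_eq]
  cases ε ω y <;> simp

theorem marked_subset (Y : Ω → Set (Space d)) (ε : Ω → Space d → Bool) (b : Bool) (ω : Ω) :
    marked Y ε b ω ⊆ Y ω := fun _ h => h.1

theorem siteSet_of_mem_bconfset {ϱ L : ℝ} {x : Space d} {B S : Finset (Space d)}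
    {Z D : Set (Space d)} (hB : (B : Set (Space d)) ⊆ sites L x)
    (hS : (S : Set (Space d)) ⊆ sites L x) (hSD : (S : Set (Space d)) ⊆ D)
    (hBD : Disjoint (B : Set (Space d)) D) (h : Z ∈ bconfset ϱ L x B S) :
    siteSet L x Z \ D = B := by
  obtain ⟨S', hS', hZ⟩ := h
  rw [siteSet_eq_of_mem_cls (union_subset hB (hS'.trans hS)) hZ, union_sdiff_distrib,
    hBD.sdiff_eq_left, sdiff_eq_empty.2 (hS'.trans hSD), union_empty]

/-- For a fixed region `D`, declare the sites of `Y` in `D` to be free. The basic events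
obtained in this way are pairwise disjoint, since `(B, B', S)` can be recovered from the
configuration. -/
theorem exists_isLocalizedEvent (u : Space d → ℝ) (δp κ σ τ ϱ : ℝ)
    (Y : Ω → Set (Space d)) (ε : Ω → Space d → Bool) (L : ℝ) (x : Space d) (E m : ℝ)
    (D : Set (Space d)) :
    ∃ W, IsLocalizedEvent u δp κ σ τ ϱ Y ε L x E m W ∧
      ∀ ω, IsAcceptable ϱ L x (Y ω) →
        (∀ B B' S : Finset (Space d), (B : Set (Space d)) = siteSet L x (marked Y ε true ω) \ D →
          (B' : Set (Space d)) = siteSet L x (marked Y ε false ω) \ D →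
          (S : Set (Space d)) = siteSet L x (Y ω) ∩ D →
          IsAdapted u δp κ σ τ ϱ L x E m B B' S) → ω ∈ W := by
  classical
  set 𝓕 : Set (Finset (Space d) × Finset (Space d) × Finset (Space d)) :=
    {T | IsAdapted u δp κ σ τ ϱ L x E m T.1 T.2.1 T.2.2 ∧ (T.2.2 : Set (Space d)) ⊆ D ∧
      Disjoint (T.1 : Set (Space d)) D ∧ Disjoint (T.2.1 : Set (Space d)) D} with h𝓕
  have hsub : ∀ T ∈ 𝓕, (T.1 : Set (Space d)) ⊆ sites L x ∧ (T.2.1 : Set (Space d)) ⊆ sites L x ∧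
      (T.2.2 : Set (Space d)) ⊆ sites L x := by
    rintro T ⟨hT, -⟩
    have h1 := hT.2.1.1
    exact ⟨fun j hj => h1 (Or.inl (Or.inl hj)), fun j hj => h1 (Or.inl (Or.inr hj)),
      fun j hj => h1 (Or.inr hj)⟩
  have hfin : 𝓕.Finite := by
    set J := (finite_sites L x).toFinset with hJ
    have hmem : ∀ Q : Finset (Space d), (Q : Set (Space d)) ⊆ sites L x → Q ∈ J.powerset := by
      intro Q hQ
      rw [Finset.mem_powerset]
      intro j hj
      rw [hJ, Set.Finite.mem_toFinset]
      exact hQ hj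
    refine (Finset.finite_toSet (J.powerset ×ˢ J.powerset ×ˢ J.powerset)).subset fun T hT => ?_
    obtain ⟨h1, h2, h3⟩ := hsub T hT
    simp only [Finset.coe_product, mem_prod, Finset.mem_coe]
    exact ⟨hmem _ h1, hmem _ h2, hmem _ h3⟩
  have hrec : ∀ T ∈ 𝓕, ∀ ω ∈ bevent ϱ Y ε L x T.1 T.2.1 T.2.2,
      (T.1 : Set (Space d)) = siteSet L x (marked Y ε true ω) \ D ∧
      (T.2.1 : Set (Space d)) = siteSet L x (marked Y ε false ω) \ D ∧
      (T.2.2 : Set (Space d)) = siteSet L x (Y ω) ∩ D := by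
    rintro T hT ω ⟨hY, hX, hX'⟩
    obtain ⟨h1, h2, h3⟩ := hsub T hT
    obtain ⟨-, hSD, hBD, hBD'⟩ := hT
    refine ⟨(siteSet_of_mem_bconfset h1 h3 hSD hBD hX).symm,
      (siteSet_of_mem_bconfset h2 h3 hSD hBD' hX').symm, ?_⟩
    rw [siteSet_eq_of_mem_cls (union_subset (union_subset h1 h2) h3) hY, union_inter_distrib_right,
      union_inter_distrib_right, hBD.inter_eq, hBD'.inter_eq, inter_eq_left.2 hSD, empty_union,
      empty_union]
  let e := hfin.toFinset.equivFin.symm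
  have he : ∀ i, (e i : Finset (Space d) × Finset (Space d) × Finset (Space d)) ∈ 𝓕 :=
    fun i => hfin.mem_toFinset.1 (e i).2
  refine ⟨_, ⟨hfin.toFinset.card, fun i => (e i).1.1, fun i => (e i).1.2.1, fun i => (e i).1.2.2,
    fun i => (he i).1, ?_, rfl⟩, ?_⟩
  · intro i i' hii
    rw [Set.disjoint_left]
    intro ω h h'
    obtain ⟨a1, a2, a3⟩ := hrec _ (he i) ω h
    obtain ⟨b1, b2, b3⟩ := hrec _ (he i') ω h'
    refine hii (e.injective (Subtype.ext (Prod.ext ?_ (Prod.ext ?_ ?_))))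
    · exact Finset.coe_injective (a1.trans b1.symm)
    · exact Finset.coe_injective (a2.trans b2.symm)
    · exact Finset.coe_injective (a3.trans b3.symm)
  · intro ω hacc hadapt
    set X := marked Y ε true ω with hX
    set X' := marked Y ε false ω with hX'
    have fB := (finite_siteSet (L := L) (x := x) X).subset (sdiff_subset (t := D))
    have fB' := (finite_siteSet (L := L) (x := x) X').subset (sdiff_subset (t := D))
    have fS := (finite_siteSet (L := L) (x := x) (Y ω)).subset (inter_subset_left (t := D))
    have hYs : siteSet L x (Y ω) = siteSet L x X ∪ siteSet L x X' := by
      rw [← siteSet_union, marked_union]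
    have hT : (fB.toFinset, fB'.toFinset, fS.toFinset) ∈ 𝓕 := by
      refine ⟨hadapt _ _ _ fB.coe_toFinset fB'.coe_toFinset fS.coe_toFinset, ?_, ?_, ?_⟩
      · simp only [Finite.coe_toFinset]; exact inter_subset_right
      · simp only [Finite.coe_toFinset]; exact disjoint_sdiff_left
      · simp only [Finite.coe_toFinset]; exact disjoint_sdiff_left
    refine mem_iUnion.2 ⟨e.symm ⟨_, hfin.mem_toFinset.2 hT⟩, ?_⟩
    simp only [Equiv.apply_symm_apply]
    refine ⟨?_, ⟨siteSet L x X ∩ D, ?_, ?_⟩, ⟨siteSet L x X' ∩ D, ?_, ?_⟩⟩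
    · simp only [Finite.coe_toFinset]
      have e1 : siteSet L x X \ D ∪ siteSet L x X' \ D ∪ siteSet L x (Y ω) ∩ D
          = siteSet L x (Y ω) := by
        rw [← union_sdiff_distrib, ← hYs, sdiff_union_inter]
      rw [e1]
      exact mem_cls_siteSet hacc
    · simp only [Finite.coe_toFinset]
      exact inter_subset_inter_left _ (hYs ▸ subset_union_left)
    · simp only [Finite.coe_toFinset]
      rw [sdiff_union_inter]
      exact mem_cls_siteSet (hacc.mono (marked_subset Y ε true ω))
    · simp only [Finite.coe_toFinset]
      exact inter_subset_inter_left _ (hYs ▸ subset_union_right)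
    · simp only [Finite.coe_toFinset]
      rw [sdiff_union_inter]
      exact mem_cls_siteSet (hacc.mono (marked_subset Y ε false ω))

end Localized

/-! ### Adapted configurations at high density -/

section Adapted

variable {d : ℕ}

/-- The point `c` with all coordinates shifted by `s`. -/
def shiftPt (s : ℝ) (c : Space d) : Space d := WithLp.toLp 2 fun i => c i + s

@[simp] theorem shiftPt_apply (s : ℝ) (c : Space d) (i : Fin d) : shiftPt s c i = c i + s := rfl

/-- The lower half (in the first coordinate) of the cells with corners in `x + a ℤ^d`. It will
contain the free sites. -/
def freeRegion (hd : 0 < d) (a : ℝ) (x : Space d) : Set (Space d) :=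
  {y | Int.fract ((y ⟨0, hd⟩ - x ⟨0, hd⟩) / a) < 1 / 2}

theorem mem_freeRegion (hd : 0 < d) {a : ℝ} (ha : 0 < a) {x : Space d} {k : Fin d → ℤ}
    {y : Space d} (h : y ∈ box (a / 2) (shiftPt (a / 4) (lat a x k))) :
    y ∈ freeRegion hd a x := by
  have h1 := abs_lt.1 (h ⟨0, hd⟩)
  simp only [shiftPt_apply, lat_apply] at h1
  have h2 : (k ⟨0, hd⟩ : ℝ) < (y ⟨0, hd⟩ - x ⟨0, hd⟩) / a := by
    rw [lt_div_iff₀ ha]; linarith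
  have h3 : (y ⟨0, hd⟩ - x ⟨0, hd⟩) / a < k ⟨0, hd⟩ + 1 / 2 := by
    rw [div_lt_iff₀ ha]; linarith
  have h4 : ⌊(y ⟨0, hd⟩ - x ⟨0, hd⟩) / a⌋ = k ⟨0, hd⟩ :=
    Int.floor_eq_iff.2 ⟨h2.le, by linarith⟩
  rw [freeRegion, mem_ofPred_eq, Int.fract, h4]
  linarith

theorem notMem_freeRegion (hd : 0 < d) {a : ℝ} (ha : 0 < a) {x : Space d} {k : Fin d → ℤ}
    {y : Space d} (h : y ∈ box (a / 2) (shiftPt (-(a / 4)) (lat a x k))) :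
    y ∉ freeRegion hd a x := by
  have h1 := abs_lt.1 (h ⟨0, hd⟩)
  simp only [shiftPt_apply, lat_apply] at h1
  have h2 : (k ⟨0, hd⟩ : ℝ) - 1 / 2 < (y ⟨0, hd⟩ - x ⟨0, hd⟩) / a := by
    rw [lt_div_iff₀ ha]; linarith
  have h3 : (y ⟨0, hd⟩ - x ⟨0, hd⟩) / a < k ⟨0, hd⟩ := by
    rw [div_lt_iff₀ ha]; linarith
  have h4 : ⌊(y ⟨0, hd⟩ - x ⟨0, hd⟩) / a⌋ = k ⟨0, hd⟩ - 1 :=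
    Int.floor_eq_iff.2 ⟨by push_cast; linarith, by push_cast; linarith⟩
  rw [freeRegion, mem_ofPred_eq, Int.fract, h4]
  push_cast
  linarith

/-- If every lattice cell in the box has at least `N` impurities in two small boxes, one outside
and one inside the free region, then the configuration defines an adapted basic event: the
impurities outside the free region already make the potential large everywhere. -/
theorem isAdapted_of_dense (hd : 0 < d) {Ω : Type*} {u : Space d → ℝ} {um up δm δp : ℝ}
    (hum : 0 < um) (hup : 0 < up)
    (hu : AEStronglyMeasurable u volume)
    (hu_lower : ∀ᵐ y : Space d, (box δm (0 : Space d)).indicator (fun _ => um) y ≤ u y)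
    (hu_upper : ∀ᵐ y : Space d, u y ≤ (box δp (0 : Space d)).indicator (fun _ => up) y)
    (hδp : 0 < δp) (κ : ℝ) {σ τ ϱ L E E₀ a : ℝ} (hE : E ∈ Icc 0 E₀) (ha : 0 < a)
    (haδ : 8 * a = δm) (hL : 20 * d ≤ L) (haL : 2 * a ≤ L) (hη : eta d L ≤ a / 8)
    (haℓ : 2 * a ≤ L ^ (1 - σ) - δp)
    (hdens : L ^ ((d : ℝ) - τ) ≤ ((L ^ (1 - σ) - δp) / a - 2) ^ d)
    (N : ℕ) (hN1 : 1 ≤ N) (hN : 2 * E₀ + 1 ≤ N * um) (x : Space d)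
    (Y : Ω → Set (Space d)) (ε : Ω → Space d → Bool) (ω : Ω)
    (hacc : IsAcceptable ϱ L x (Y ω))
    (hpt : ∀ k, box a (lat a x k) ⊆ box L x → ∀ s ∈ ({a / 4, -(a / 4)} : Set ℝ),
      (N : ℕ∞) ≤ (marked Y ε true ω ∩ box (a / 4) (shiftPt s (lat a x k))).encard)
    (B B' S : Finset (Space d))
    (hB : (B : Set (Space d)) = siteSet L x (marked Y ε true ω) \ freeRegion hd a x)
    (hB' : (B' : Set (Space d)) = siteSet L x (marked Y ε false ω) \ freeRegion hd a x)
    (hS : (S : Set (Space d)) = siteSet L x (Y ω) ∩ freeRegion hd a x) :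
    IsAdapted u δp κ σ τ ϱ L x E (Real.sqrt E₀ / 2) B B' S := by
  set D := freeRegion hd a x with hD
  set X := marked Y ε true ω with hX
  set X' := marked Y ε false ω with hX'
  have hXY : X ⊆ Y ω := marked_subset Y ε true ω
  have hX'Y : X' ⊆ Y ω := marked_subset Y ε false ω
  have hYs : siteSet L x (Y ω) = siteSet L x X ∪ siteSet L x X' := by
    rw [← siteSet_union, marked_union]
  have hsmall : ∀ k, ∀ s ∈ ({a / 4, -(a / 4)} : Set ℝ),
      box (a / 2) (shiftPt s (lat a x k)) ⊆ box a (lat a x k) := by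
    intro k s hs
    refine box_subset_box fun i => ?_
    rw [shiftPt_apply, add_sub_cancel_left]
    have : |s| = a / 4 := by
      rcases hs with rfl | rfl
      · exact abs_of_pos (by linarith)
      · rw [abs_neg]; exact abs_of_pos (by linarith)
    linarith
  have hsite : ∀ c p : Space d, p ∈ box (a / 4) c → ∀ j, p ∈ box (eta d L) j →
      j ∈ box (a / 2) c := by
    intro c p hp j hj i
    have h1 := abs_lt.1 (hp i)
    have h2 := abs_lt.1 (hj i)
    rw [abs_lt]
    constructor <;> linarith
  have hinner : ∀ c : Space d, box (a / 4) c ⊆ box (a / 2) c := fun c p hp i =>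
    (hp i).trans (by linarith)
  -- the sites produced by the small box with shift `s`
  have hcount : ∀ k, box a (lat a x k) ⊆ box L x → ∀ s ∈ ({a / 4, -(a / 4)} : Set ℝ),
      (N : ℕ∞) ≤ (siteSet L x X ∩ box (a / 2) (shiftPt s (lat a x k))).encard := by
    intro k hk s hs
    exact (hpt k hk s hs).trans (hacc.encard_le_encard_siteSet hXY
      ((hinner _).trans ((hsmall k s hs).trans hk)) (hsite _))
  have dBB' : Disjoint B B' := by
    rw [← Finset.disjoint_coe, hB, hB', Set.disjoint_left]
    rintro j ⟨⟨hj, p, hp, hpj⟩, -⟩ ⟨⟨-, p', hp', hpj'⟩, -⟩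
    have := encard_le_one_iff.1 (hacc.2.2.1 j hj) p p' ⟨hXY hp, hpj⟩ ⟨hX'Y hp', hpj'⟩
    subst this
    have h1 : ε ω p = true := hp.2
    have h2 : ε ω p = false := hp'.2
    rw [h1] at h2
    exact absurd h2 (by decide)
  have dBS : Disjoint B S := by
    rw [← Finset.disjoint_coe, hB, hS]
    exact disjoint_sdiff_left.mono_right inter_subset_right
  have dB'S : Disjoint B' S := by
    rw [← Finset.disjoint_coe, hB', hS]
    exact disjoint_sdiff_left.mono_right inter_subset_right
  refine ⟨⟨dBB', dBS, dB'S⟩, ?_, ?_, ?_⟩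
  · have e1 : (B : Set (Space d)) ∪ B' ∪ S = siteSet L x (Y ω) := by
      rw [hB, hB', hS, ← union_sdiff_distrib, ← hYs, sdiff_union_inter]
    rw [e1]
    exact ⟨siteSet_subset _, finite_siteSet _, ncard_siteSet_lt hacc⟩
  · intro z hz
    set ℓ := L ^ (1 - σ) with hℓ
    obtain ⟨F, hF, hcard⟩ := exists_finset_lat ha haℓ x z
    refine hdens.trans (hcard.trans ?_)
    have hzz : box (ℓ - δp) z ⊆ box L x := by
      have h1 : box (ℓ - δp) z ⊆ box ℓ z := fun p hp i => (hp i).trans (by linarith)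
      exact h1.trans hz
    have hj : ∀ k, k ∈ F → ∃ j, j ∈ siteSet L x X ∩ box (a / 2) (shiftPt (a / 4) (lat a x k)) := by
      intro k hk
      refine one_le_encard_iff_nonempty.1 (le_trans ?_
        (hcount k ((hF k hk).trans hzz) (a / 4) (Or.inl rfl)))
      exact_mod_cast hN1
    choose! j hj using hj
    rw [← Set.ncard_coe_finset F]
    have hSfin : ((S : Set (Space d)) ∩ box (ℓ - δp) z).Finite :=
      S.finite_toSet.subset inter_subset_left
    have hja : ∀ k ∈ F, j k ∈ box a (lat a x k) := fun k hk =>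
      hsmall k (a / 4) (Or.inl rfl) (hj k hk).2
    refine Nat.cast_le.2 (ncard_le_ncard_of_injOn j (fun k hk => ⟨?_, ?_⟩) ?_ hSfin)
    · rw [hS, hYs]
      exact ⟨Or.inl (hj k hk).1, mem_freeRegion hd ha (hj k hk).2⟩
    · exact hF k hk (hja k hk)
    · intro k hk k' hk' he
      exact eq_of_mem_box_lat ha (hja k hk) (he ▸ hja k' hk')
  · refine isGoodBox_of_cover hum hup hu hu_lower hu_upper κ hE hL x B S dBS ?_ N hN ?_
    · intro ζ hζ
      have h1 : ζ ∈ (B : Set (Space d)) := hζ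
      rw [hB] at h1
      exact sites_subset_box h1.1.1
    · intro y hy
      obtain ⟨k, hk, hky⟩ := exists_lat_near ha haL hy
      have hs : -(a / 4) ∈ ({a / 4, -(a / 4)} : Set ℝ) := Or.inr rfl
      have h1 := hcount k hk _ hs
      have h2 : siteSet L x X ∩ box (a / 2) (shiftPt (-(a / 4)) (lat a x k))
          ⊆ (B : Set (Space d)) ∩ box δm y := by
        rintro j ⟨hj1, hj2⟩
        refine ⟨?_, fun i => ?_⟩
        · rw [hB]
          exact ⟨hj1, notMem_freeRegion hd ha hj2⟩
        · have h3 := abs_lt.1 (hsmall k _ hs hj2 i)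
          have h4 := abs_le.1 (hky i)
          rw [abs_lt]
          constructor <;> linarith
      have h3 := h1.trans (encard_le_encard h2)
      rw [← (B.finite_toSet.subset inter_subset_left).cast_ncard_eq] at h3
      exact_mod_cast h3

end Adapted

/-! ### Probability of the good configurations -/

section Probability

variable {d : ℕ}

theorem real_smul_volume_box {c a : ℝ} (hc : 0 ≤ c) (ha : 0 ≤ a) (x : Space d) :
    (ENNReal.ofReal c • (volume : Measure (Space d))).real (box a x) = c * a ^ d := by
  rw [Measure.real, Measure.smul_apply, volume_box, smul_eq_mul, ENNReal.toReal_mul,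
    ENNReal.toReal_pow, ENNReal.toReal_ofReal hc, ENNReal.toReal_ofReal ha]

theorem smul_volume_lt_top (c : ℝ) {A : Set (Space d)} (hA : Bornology.IsBounded A) :
    (ENNReal.ofReal c • (volume : Measure (Space d))) A < ∞ := by
  rw [Measure.smul_apply, smul_eq_mul]
  exact ENNReal.mul_lt_top ENNReal.ofReal_lt_top hA.measure_lt_top

theorem eta_lt_one {L : ℝ} (hL : 0 < L) : eta d L < 1 := by
  rw [eta, Real.exp_lt_one_iff]
  exact neg_lt_zero.2 (by positivity)

theorem card_sites_le {L : ℝ} (hL : 0 ≤ L) (x : Space d) :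
    ((finite_sites L x).toFinset.card : ℝ) ≤ (L / eta d L) ^ d := by
  classical
  set F := (finite_lat_subset (eta_pos d L) L x).toFinset with hF
  have h1 : (finite_sites L x).toFinset ⊆ F.image (lat (eta d L) x) := by
    intro j hj
    obtain ⟨k, hk, rfl⟩ := mem_sites_iff.1 ((finite_sites L x).mem_toFinset.1 hj)
    exact Finset.mem_image_of_mem _ ((finite_lat_subset (eta_pos d L) L x).mem_toFinset.2 hk)
  have h2 : (finite_sites L x).toFinset.card ≤ F.card :=
    (Finset.card_le_card h1).trans Finset.card_image_le
  refine le_trans (by exact_mod_cast h2) (card_lat_le (eta_pos d L) hL x F fun k hk => ?_)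
  exact (finite_lat_subset (eta_pos d L) L x).mem_toFinset.1 hk

theorem le_card_sites {L : ℝ} (hηL : 2 * eta d L ≤ L) (x : Space d) :
    (L / eta d L - 2) ^ d ≤ ((finite_sites L x).toFinset.card : ℝ) := by
  classical
  obtain ⟨F, hF, hcard⟩ := exists_finset_lat (eta_pos d L) hηL x x
  refine hcard.trans ?_
  have h1 : F.image (lat (eta d L) x) ⊆ (finite_sites L x).toFinset := by
    intro j hj
    obtain ⟨k, hk, rfl⟩ := Finset.mem_image.1 hj
    exact (finite_sites L x).mem_toFinset.2 (mem_sites_iff.2 ⟨k, hF k hk, rfl⟩)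
  have h2 := Finset.card_le_card h1
  rw [Finset.card_image_of_injOn] at h2
  · exact_mod_cast h2
  · intro k _ k' _ he
    refine eq_of_mem_box_lat (eta_pos d L) (x := x) (self_mem_box (eta_pos d L) _) ?_
    rw [he]
    exact self_mem_box (eta_pos d L) _

/-- The part of `Λ_L(x)` which an acceptable configuration has to avoid. -/
def forbidden (L : ℝ) (x : Space d) : Set (Space d) :=
  box L x \ ⋃ j ∈ sites L x, box (eta d L * (1 - eta d L)) j

theorem measurableSet_forbidden (L : ℝ) (x : Space d) : MeasurableSet (forbidden L x) :=
  (measurableSet_box L x).diff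
    (MeasurableSet.biUnion (finite_sites L x).countable fun _ _ => measurableSet_box _ _)

theorem real_volume_forbidden_le {L : ℝ} (hL : 0 < L) (hηL : 2 * eta d L ≤ L) (x : Space d) :
    (volume : Measure (Space d)).real (forbidden L x)
      ≤ L ^ d - ((L - 2 * eta d L) * (1 - eta d L)) ^ d := by
  set η := eta d L with hη
  have h0 : 0 < η := eta_pos d L
  have h1 : η < 1 := eta_lt_one hL
  set J := (finite_sites L x).toFinset with hJ
  have hsub : ∀ j : Space d, box (η * (1 - η)) j ⊆ box η j := fun j p hp i =>
    (hp i).trans_le (by nlinarith)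
  have hU : (⋃ j ∈ sites L x, box (η * (1 - η)) j) = ⋃ j ∈ J, box (η * (1 - η)) j := by
    simp [hJ]
  have hUL : (⋃ j ∈ sites L x, box (η * (1 - η)) j) ⊆ box L x :=
    iUnion₂_subset fun j hj => (hsub j).trans hj.2
  have hreal : ∀ (s : ℝ) (c : Space d), 0 ≤ s →
      (volume : Measure (Space d)).real (box s c) = s ^ d := fun s c hs => by
    rw [Measure.real, volume_box, ENNReal.toReal_pow, ENNReal.toReal_ofReal hs]
  have hlt : ∀ j ∈ J, (volume : Measure (Space d)) (box (η * (1 - η)) j) ≠ ∞ :=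
    fun j _ => (isBounded_box _ _).measure_lt_top.ne
  have hvolU : (volume : Measure (Space d)).real (⋃ j ∈ sites L x, box (η * (1 - η)) j)
      = J.card * (η * (1 - η)) ^ d := by
    rw [hU, measureReal_biUnion_finset (h := hlt)]
    · rw [Finset.sum_congr rfl fun j _ => hreal _ j (by nlinarith)]
      simp
    · intro j hj j' hj' hjj
      rw [Function.onFun, Set.disjoint_left]
      intro p hp hp'
      exact hjj (site_unique ((finite_sites L x).mem_toFinset.1 hj)
        ((finite_sites L x).mem_toFinset.1 hj') (hsub j hp) (hsub j' hp'))
    · exact fun j _ => measurableSet_box _ _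
  rw [forbidden, measureReal_sdiff hUL
    (MeasurableSet.biUnion (finite_sites L x).countable fun _ _ => measurableSet_box _ _)
    (isBounded_box L x).measure_lt_top.ne, hvolU, hreal L x hL.le]
  have h2 := mul_le_mul_of_nonneg_right (le_card_sites hηL x)
    (show 0 ≤ (η * (1 - η)) ^ d from pow_nonneg (mul_nonneg h0.le (by linarith)) d)
  rw [← mul_pow] at h2
  have h3 : (L / η - 2) * (η * (1 - η)) = (L - 2 * η) * (1 - η) := by
    field_simp
  rw [← hη, h3] at h2
  linarith

/-- The configuration is acceptable and its impurities are dense on the scale `a`. -/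
def IsGoodConfig {Ω : Type*} (ϱ : ℝ) (Y : Ω → Set (Space d)) (ε : Ω → Space d → Bool)
    (L : ℝ) (x : Space d) (a : ℝ) (N : ℕ) (ω : Ω) : Prop :=
  IsAcceptable ϱ L x (Y ω) ∧
    ∀ k, box a (lat a x k) ⊆ box L x → ∀ s ∈ ({a / 4, -(a / 4)} : Set ℝ),
      (N : ℕ∞) ≤ (marked Y ε true ω ∩ box (a / 4) (shiftPt s (lat a x k))).encard

variable {Ω : Type*} [MeasurableSpace Ω] {P : Measure Ω} [IsProbabilityMeasure P] {ϱ : ℝ}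
  {Y : Ω → Set (Space d)} {ε : Ω → Space d → Bool}

theorem real_not_isGoodConfig_le (h : IsMarkedPoisson P ϱ Y ε) (hϱ : 0 < ϱ) {L a : ℝ}
    (hL : 0 < L) (ha : 0 < a) (hηL : 2 * eta d L ≤ L) (x : Space d) (N : ℕ) :
    P.real {ω | ¬ IsGoodConfig ϱ Y ε L x a N ω} ≤
      2 * (L / a) ^ d * (2 ^ N * Real.exp (-(ϱ * (a / 4) ^ d / 2)))
      + Real.exp (-(12 * ϱ * L ^ d))
      + (L / eta d L) ^ d * (2 * ϱ * eta d L ^ d) ^ 2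
      + 2 * ϱ * (L ^ d - ((L - 2 * eta d L) * (1 - eta d L)) ^ d) := by
  classical
  have hpY := h.poisson
  have hpX := h.poisson_marked
  set n : ℕ := ⌈16 * ϱ * L ^ d⌉₊ with hn
  set F := (finite_lat_subset ha L x).toFinset with hF
  have hFmem : ∀ k, k ∈ F ↔ box a (lat a x k) ⊆ box L x :=
    fun k => (finite_lat_subset ha L x).mem_toFinset
  set J := (finite_sites L x).toFinset with hJ
  set I : Finset ((Fin d → ℤ) × ℝ) := F ×ˢ {a / 4, -(a / 4)} with hI
  set b1 : Set Ω := ⋃ q ∈ I,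
    {ω | (marked Y ε true ω ∩ box (a / 4) (shiftPt q.2 (lat a x q.1))).encard < N} with hb1
  set b2 : Set Ω := {ω | (n : ℕ∞) ≤ (Y ω ∩ box L x).encard} with hb2
  set b3 : Set Ω := ⋃ j ∈ J, {ω | ((2 : ℕ) : ℕ∞) ≤ (Y ω ∩ box (eta d L) j).encard} with hb3
  set b4 : Set Ω := {ω | ((1 : ℕ) : ℕ∞) ≤ (Y ω ∩ forbidden L x).encard} with hb4
  have hsub : {ω | ¬ IsGoodConfig ϱ Y ε L x a N ω} ⊆ b1 ∪ b2 ∪ b3 ∪ b4 := by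
    intro ω hω
    by_contra hc
    simp only [mem_union, not_or] at hc
    obtain ⟨⟨⟨c1, c2⟩, c3⟩, c4⟩ := hc
    refine hω ⟨⟨h.countable ω, ?_, fun j hj => ?_, ?_⟩, fun k hk s hs => ?_⟩
    · have c2' : (Y ω ∩ box L x).encard < n := not_le.1 c2
      have hfin : (Y ω ∩ box L x).Finite := finite_of_encard_le_coe c2'.le
      refine ⟨hfin, ?_⟩
      rw [← hfin.cast_ncard_eq] at c2'
      exact Nat.lt_ceil.1 (by exact_mod_cast c2')
    · by_contra hlt
      refine c3 (mem_iUnion₂.2 ⟨j, (finite_sites L x).mem_toFinset.2 hj, ?_⟩)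
      have := Order.add_one_le_of_lt (not_le.1 hlt)
      rw [one_add_one_eq_two] at this
      exact this
    · by_contra hne
      refine c4 ?_
      have := one_le_encard_iff_nonempty.2 (nonempty_iff_ne_empty.2 hne)
      simpa [hb4, forbidden] using this
    · by_contra hlt
      refine c1 (mem_iUnion₂.2 ⟨(k, s), Finset.mem_product.2 ⟨(hFmem k).2 hk, ?_⟩, not_le.1 hlt⟩)
      simpa using hs
  have p1 : P.real b1 ≤ 2 * (L / a) ^ d * (2 ^ N * Real.exp (-(ϱ * (a / 4) ^ d / 2))) := by
    have hcard : (I.card : ℝ) ≤ 2 * (L / a) ^ d := by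
      have h1 : I.card ≤ F.card * 2 := by
        rw [hI, Finset.card_product]
        exact Nat.mul_le_mul_left _ Finset.card_le_two
      have h2 := card_lat_le ha hL.le x F fun k hk => (hFmem k).1 hk
      have h3 : (I.card : ℝ) ≤ F.card * 2 := by exact_mod_cast h1
      linarith
    refine (measureReal_biUnion_finset_le _ _).trans ?_
    refine (Finset.sum_le_sum (g := fun _ => 2 ^ N * Real.exp (-(ϱ * (a / 4) ^ d / 2)))
      fun q _ => ?_).trans ?_
    · have h1 := hpX.real_lt_le (measurableSet_box (a / 4) (shiftPt q.2 (lat a x q.1)))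
        (smul_volume_lt_top _ (isBounded_box _ _)) N
      rwa [real_smul_volume_box hϱ.le (by positivity)] at h1
    · rw [Finset.sum_const, nsmul_eq_mul]
      gcongr
  have p2 : P.real b2 ≤ Real.exp (-(12 * ϱ * L ^ d)) := by
    refine (hpY.real_ge_le (measurableSet_box L x)
      (smul_volume_lt_top _ (isBounded_box _ _)) n).trans (Real.exp_le_exp.2 ?_)
    rw [real_smul_volume_box (by positivity) hL.le]
    have h1 : 16 * ϱ * L ^ d ≤ n := Nat.le_ceil _
    -- mean `2 ϱ L^d` against threshold `16 ϱ L^d`: the exponent is `2 (e - 1) - 16 ≤ -12`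
    have h2 : Real.exp 1 ≤ 3 := Real.exp_one_lt_three.le
    have h3 : 0 < ϱ * L ^ d := by positivity
    nlinarith
  have p3 : P.real b3 ≤ (L / eta d L) ^ d * (2 * ϱ * eta d L ^ d) ^ 2 := by
    refine (measureReal_biUnion_finset_le _ _).trans ?_
    refine (Finset.sum_le_sum (g := fun _ => (2 * ϱ * eta d L ^ d) ^ 2) fun j _ => ?_).trans ?_
    · have h1 := hpY.real_two_le (measurableSet_box (eta d L) j)
        (smul_volume_lt_top _ (isBounded_box _ _))
      rwa [real_smul_volume_box (by positivity) (eta_pos d L).le] at h1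
    · rw [Finset.sum_const, nsmul_eq_mul]
      gcongr
      exact card_sites_le hL.le x
  have p4 : P.real b4 ≤ 2 * ϱ * (L ^ d - ((L - 2 * eta d L) * (1 - eta d L)) ^ d) := by
    refine (hpY.real_one_le (measurableSet_forbidden L x)
      (smul_volume_lt_top _ ((isBounded_box L x).subset sdiff_subset))).trans ?_
    rw [measureReal_ennreal_smul_apply, ENNReal.toReal_ofReal (by positivity)]
    gcongr
    exact real_volume_forbidden_le hL hηL x
  refine (measureReal_mono hsub).trans ?_
  have u1 := measureReal_union_le (μ := P) (b1 ∪ b2 ∪ b3) b4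
  have u2 := measureReal_union_le (μ := P) (b1 ∪ b2) b3
  have u3 := measureReal_union_le (μ := P) b1 b2
  linarith

end Probability

/-! ### Large scales -/

section Asymptotics

/-- `η_L` beats every fixed power of `exp (L^d)`; the power `5` suffices for the union bounds. -/
theorem eta_le_exp {d : ℕ} (hd : 0 < d) {L : ℝ} (hL : 5 ≤ L) :
    eta d L ≤ Real.exp (-(5 * L ^ d)) := by
  rw [eta]
  refine Real.exp_le_exp.2 (neg_le_neg ?_)
  have h1 : L ≤ L ^ d := le_self_pow₀ (by linarith) hd.ne'
  have h2 : L ^ (2 * d) ≤ L ^ (10 ^ 6 * d) :=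
    pow_le_pow_right₀ (by linarith) (Nat.mul_le_mul_right d (by norm_num))
  rw [two_mul, pow_add] at h2
  nlinarith

/-- The probability bound for the bad configurations is small at large scales. -/
theorem bad_bound_lt {d : ℕ} (hd : 0 < d) {L ϱ a p : ℝ} {N : ℕ} (hp : 0 < p) (ha : 0 < a)
    (hϱ : 0 < ϱ) (hL5 : 5 ≤ L) (hLd : d ≤ L) (hexp : Real.exp (-L) ≤ L ^ (-(p + 1)))
    (hK : 2 ^ (N + 1) / a ^ d + 11 < L)
    (hC : ((p + 1) + 2 * (4 / a) ^ d * (d + p + 1)) * Real.log L ≤ ϱ)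
    (hϱ2 : ϱ ≤ Real.exp (L ^ d)) :
    2 * (L / a) ^ d * (2 ^ N * Real.exp (-(ϱ * (a / 4) ^ d / 2)))
      + Real.exp (-(12 * ϱ * L ^ d))
      + (L / eta d L) ^ d * (2 * ϱ * eta d L ^ d) ^ 2
      + 2 * ϱ * (L ^ d - ((L - 2 * eta d L) * (1 - eta d L)) ^ d) < L ^ (-p) := by
  have hL0 : 0 < L := by linarith
  have hlog : 0 ≤ Real.log L := Real.log_nonneg (by linarith)
  have hrpow : ∀ s : ℝ, Real.exp (-(s * Real.log L)) = L ^ (-s) := fun s => by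
    rw [Real.rpow_def_of_pos hL0]; congr 1; ring
  set T := L ^ d with hT
  have hLT : L ≤ T := le_self_pow₀ (by linarith) hd.ne'
  set η := eta d L with hη
  have hη0 : 0 < η := eta_pos d L
  have hη1 : η < 1 := eta_lt_one hL0
  have hηT : η ≤ Real.exp (-(5 * T)) := eta_le_exp hd hL5
  have t1 : 2 * (L / a) ^ d * (2 ^ N * Real.exp (-(ϱ * (a / 4) ^ d / 2)))
      ≤ 2 ^ (N + 1) / a ^ d * L ^ (-(p + 1)) := by
    have e1 : (d + p + 1) * Real.log L ≤ ϱ * (a / 4) ^ d / 2 := by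
      have e2 : (4 / a) ^ d * (a / 4) ^ d = 1 := by
        rw [← mul_pow, div_mul_div_comm, mul_comm 4 a, div_self (by positivity), one_pow]
      have e3 : 2 * (4 / a) ^ d * (d + p + 1) * Real.log L ≤ ϱ := by
        have := mul_nonneg (show 0 ≤ p + 1 by linarith) hlog
        linarith
      have e4 := mul_le_mul_of_nonneg_right e3 (show 0 ≤ (a / 4) ^ d by positivity)
      have e5 : 2 * (4 / a) ^ d * (d + p + 1) * Real.log L * (a / 4) ^ d
          = 2 * ((d + p + 1) * Real.log L) * ((4 / a) ^ d * (a / 4) ^ d) := by ring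
      rw [e5, e2] at e4
      linarith
    have e6 : Real.exp (-(ϱ * (a / 4) ^ d / 2)) ≤ L ^ (-(d + p + 1) : ℝ) := by
      rw [← hrpow]
      exact Real.exp_le_exp.2 (neg_le_neg e1)
    have e7 : L ^ d * L ^ (-(d + p + 1) : ℝ) = L ^ (-(p + 1)) := by
      rw [← Real.rpow_natCast L d, ← Real.rpow_add hL0]; congr 1; ring
    calc _ ≤ 2 * (L / a) ^ d * (2 ^ N * L ^ (-(d + p + 1) : ℝ)) := by gcongr
      _ = 2 ^ (N + 1) / a ^ d * (L ^ d * L ^ (-(d + p + 1) : ℝ)) := by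
        rw [div_pow, pow_succ]; ring
      _ = _ := by rw [e7]
  have t2 : Real.exp (-(12 * ϱ * T)) ≤ L ^ (-(p + 1)) := by
    rw [← hrpow]
    refine Real.exp_le_exp.2 (neg_le_neg ?_)
    have e1 : 0 ≤ 2 * (4 / a) ^ d * (d + p + 1) * Real.log L := by positivity
    have e2 : (p + 1) * Real.log L ≤ ϱ := by linarith
    nlinarith
  -- the last two terms carry the factor `η`
  have hsmall : L * T * Real.exp (2 * T) * η ≤ L ^ (-(p + 1)) := by
    have e1 : T ≤ Real.exp T := by linarith [Real.add_one_le_exp T]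
    calc L * T * Real.exp (2 * T) * η
        ≤ Real.exp T * Real.exp T * Real.exp (2 * T) * Real.exp (-(5 * T)) := by
          gcongr; exact hLT.trans e1
      _ = Real.exp (-T) := by
          rw [← Real.exp_add, ← Real.exp_add, ← Real.exp_add]; congr 1; ring
      _ ≤ Real.exp (-L) := Real.exp_le_exp.2 (neg_le_neg hLT)
      _ ≤ _ := hexp
  have hT0 : 0 < T := by positivity
  have t3 : (L / η) ^ d * (2 * ϱ * η ^ d) ^ 2 ≤ 4 * (L * T * Real.exp (2 * T) * η) := by
    have e1 : (L / η) ^ d * (2 * ϱ * η ^ d) ^ 2 = 4 * (T * ϱ ^ 2 * η ^ d) := by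
      rw [div_pow]; field_simp; ring
    have e2 : η ^ d ≤ η := pow_le_of_le_one hη0.le hη1.le hd.ne'
    have e3 : ϱ ^ 2 ≤ Real.exp (2 * T) := by
      rw [two_mul, Real.exp_add, sq]; gcongr
    rw [e1]
    calc 4 * (T * ϱ ^ 2 * η ^ d) ≤ 4 * (T * Real.exp (2 * T) * η) := by gcongr
      _ ≤ 4 * (L * T * Real.exp (2 * T) * η) := by
        rw [mul_assoc L, mul_assoc L]
        have : 0 ≤ T * Real.exp (2 * T) * η := by positivity
        nlinarith
  have t4 : 2 * ϱ * (T - ((L - 2 * η) * (1 - η)) ^ d) ≤ 6 * (L * T * Real.exp (2 * T) * η) := by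
    have hη3 : 3 * η ≤ 1 := by
      have e1 : Real.exp (-(5 * T)) ≤ Real.exp (-2) := Real.exp_le_exp.2 (by linarith)
      have e2 := Real.add_one_le_exp (2 : ℝ)
      have e3 : Real.exp (-2) * Real.exp 2 = 1 := by rw [← Real.exp_add]; simp
      nlinarith [Real.exp_pos (-2)]
    have e1 : L * (1 - 3 * η) ≤ (L - 2 * η) * (1 - η) := by nlinarith
    have e2 : (L * (1 - 3 * η)) ^ d ≤ ((L - 2 * η) * (1 - η)) ^ d :=
      pow_le_pow_left₀ (mul_nonneg hL0.le (by linarith)) e1 d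
    have e3 := one_add_mul_le_pow (a := -(3 * η)) (by linarith) d
    rw [mul_pow, ← hT] at e2
    have e4 : T - ((L - 2 * η) * (1 - η)) ^ d ≤ T * (3 * d * η) := by
      rw [← sub_eq_add_neg] at e3
      nlinarith
    have e5 : ϱ ≤ Real.exp (2 * T) := hϱ2.trans (Real.exp_le_exp.2 (by linarith))
    calc 2 * ϱ * (T - ((L - 2 * η) * (1 - η)) ^ d) ≤ 2 * ϱ * (T * (3 * d * η)) := by gcongr
      _ ≤ 2 * Real.exp (2 * T) * (T * (3 * L * η)) := by gcongr
      _ = _ := by ring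
  have hfin : (2 ^ (N + 1) / a ^ d + 11) * L ^ (-(p + 1)) < L ^ (-p) := by
    have e1 : L ^ (-p) = L * L ^ (-(p + 1)) := by
      rw [← Real.rpow_one_add' hL0.le (by linarith)]; congr 1; ring
    rw [e1]
    exact mul_lt_mul_of_pos_right hK (Real.rpow_pos_of_pos hL0 _)
  linarith

/-- All the conditions on the scale hold for large `L`. -/
theorem eventually_scale {d : ℕ} (hd : 0 < d) {σ τ a δp : ℝ} (p K : ℝ) (ha : 0 < a)
    (hστ : d * σ < τ) (hτ : τ < d) :
    ∀ᶠ L : ℝ in atTop, 5 ≤ L ∧ 20 * (d : ℝ) ≤ L ∧ 2 * a ≤ L ∧ K < L ∧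
      Real.exp (-L) ≤ L ^ (-(p + 1)) ∧ eta d L ≤ a / 8 ∧ 2 * a ≤ L ^ (1 - σ) - δp ∧
      L ^ ((d : ℝ) - τ) ≤ ((L ^ (1 - σ) - δp) / a - 2) ^ d := by
  have hd' : (0 : ℝ) < d := by exact_mod_cast hd
  have hσ1 : 0 < 1 - σ := by nlinarith
  have l1 := tendsto_rpow_atTop hσ1
  have l2 := tendsto_rpow_atTop (show 0 < τ - d * σ by linarith)
  have l3 : Tendsto (fun L : ℝ => Real.exp (-L)) atTop (𝓝 0) := Real.tendsto_exp_neg_atTop_nhds_zero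
  have l4 : Tendsto (fun L : ℝ => L ^ (p + 1) * Real.exp (-1 * L)) atTop (𝓝 0) :=
    tendsto_rpow_mul_exp_neg_mul_atTop_nhds_zero (p + 1) 1 one_pos
  filter_upwards [eventually_ge_atTop 5, eventually_ge_atTop (20 * (d : ℝ)),
    eventually_ge_atTop (2 * a), eventually_gt_atTop K, l4.eventually_le_const one_pos,
    l3.eventually_le_const (show 0 < a / 8 by positivity),
    l1.eventually_ge_atTop (2 * a + δp), l1.eventually_ge_atTop (2 * δp + 4 * a),
    l2.eventually_ge_atTop ((2 * a) ^ d)] with L h1 h2 h3 h4 h5 h6 h7 h8 h9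
  have hL0 : 0 < L := by linarith
  refine ⟨h1, h2, h3, h4, ?_, ?_, by linarith, ?_⟩
  · rw [Real.rpow_neg hL0.le, ← one_div, le_div_iff₀ (Real.rpow_pos_of_pos hL0 _), mul_comm]
    simpa using h5
  · refine (eta_le_exp hd h1).trans (le_trans (Real.exp_le_exp.2 ?_) h6)
    have : L ≤ L ^ d := le_self_pow₀ (by linarith) hd.ne'
    linarith
  · have e1 : L ^ (1 - σ) / (2 * a) ≤ (L ^ (1 - σ) - δp) / a - 2 := by
      rw [div_le_iff₀ (by positivity)]
      have : ((L ^ (1 - σ) - δp) / a - 2) * (2 * a) = 2 * (L ^ (1 - σ) - δp) - 4 * a := by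
        field_simp
        ring
      rw [this]
      linarith
    refine le_trans ?_ (pow_le_pow_left₀ (by positivity) e1 d)
    rw [div_pow, le_div_iff₀ (by positivity), ← Real.rpow_mul_natCast hL0.le]
    calc L ^ ((d : ℝ) - τ) * (2 * a) ^ d ≤ L ^ ((d : ℝ) - τ) * L ^ (τ - d * σ) := by gcongr
      _ = L ^ ((1 - σ) * d) := by rw [← Real.rpow_add hL0]; congr 1; ring

end Asymptotics

end PoissonLoc
end

open PoissonLoc
theorem proposition4p2 (d : ℕ) (hd : 0 < d)
    (u : Space d → ℝ) (um up δm δp : ℝ) (hum : 0 < um) (hup : 0 < up) (hδm : 0 < δm) (hδp : 0 < δp)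
    (hu : AEStronglyMeasurable u volume)
    (hu_lower : ∀ᵐ y : Space d, (box δm (0 : Space d)).indicator (fun _ => um) y ≤ u y)
    (hu_upper : ∀ᵐ y : Space d, u y ≤ (box δp (0 : Space d)).indicator (fun _ => up) y)
    (p : ℝ) (hp : 0 < p) (E₀ : ℝ) (hE₀ : 0 < E₀) :
    ∃ C : ℝ, 0 < C ∧
      ∀ κ σ τ θ : ℝ, 0 < κ → κ < 1 → 0 < σ → d * σ < τ → τ < d → 0 < θ →
        ∃ L₀ : ℝ, 0 < L₀ ∧
          ∀ L ϱ : ℝ, L₀ ≤ L → C * Real.log L ≤ ϱ → 0 < ϱ →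
            L ^ (-θ) ≤ ϱ → ϱ ≤ Real.exp (L ^ d) →
            ∀ (Ω : Type*) [MeasurableSpace Ω] (P : Measure Ω) [IsProbabilityMeasure P]
              (Y : Ω → Set (Space d)) (ε : Ω → Space d → Bool),
              IsMarkedPoisson P ϱ Y ε →
              ∀ E ∈ Icc (0 : ℝ) E₀,
                IsLocalizing P u δp κ σ τ ϱ Y ε p E (Real.sqrt E₀ / 2) L := by
  -- the side of the cells: a point is at distance at most `2 a < δm / 2` from the sites of a cell
  set a : ℝ := δm / 8 with ha_def
  have ha : 0 < a := by positivity
  obtain ⟨N₀, hN₀⟩ := exists_nat_ge ((2 * E₀ + 1) / um)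
  set N := N₀ + 1 with hN_def
  have hN : 2 * E₀ + 1 ≤ N * um := by
    rw [div_le_iff₀ hum] at hN₀
    push_cast [hN_def]
    linarith
  refine ⟨(p + 1) + 2 * (4 / a) ^ d * (d + p + 1), by positivity, ?_⟩
  intro κ σ τ θ _ _ _ hστ hτ _
  obtain ⟨L₀, hL₀⟩ := eventually_atTop.1
    (eventually_scale hd (δp := δp) p (2 ^ (N + 1) / a ^ d + 11) ha hστ hτ)
  refine ⟨max L₀ 1, lt_max_of_lt_right one_pos, ?_⟩
  intro L ϱ hL hC hϱ _ hϱ2 Ω _ P _ Y ε hYε E hE x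
  obtain ⟨h5, h20, haL, hK, hexp, hη, haℓ, hdens⟩ := hL₀ L ((le_max_left _ _).trans hL)
  have hL0 : 0 < L := by linarith
  obtain ⟨W, hW, hmem⟩ := exists_isLocalizedEvent u δp κ σ τ ϱ Y ε L x E (Real.sqrt E₀ / 2)
    (freeRegion hd a x)
  refine ⟨W, hW, ?_⟩
  have hgood : Wᶜ ⊆ {ω | ¬ IsGoodConfig ϱ Y ε L x a N ω} := by
    intro ω hω hgood
    refine hω (hmem ω hgood.1 fun B B' S hB hB' hS => ?_)
    exact isAdapted_of_dense hd hum hup hu hu_lower hu_upper hδp κ hE ha (by rw [ha_def]; ring)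
      h20 haL hη haℓ hdens N (Nat.le_add_left 1 N₀) hN x Y ε ω hgood.1 hgood.2 B B' S hB hB' hS
  have hbad := (real_not_isGoodConfig_le hYε hϱ hL0 ha
    (by linarith [eta_lt_one (d := d) hL0]) x N).trans_lt
    (bad_bound_lt hd hp ha hϱ h5 (by linarith [Nat.cast_nonneg (α := ℝ) d]) hexp hK hC hϱ2)
  have h1 : (1 : ℝ) ≤ P.real W + P.real Wᶜ := by
    have := measureReal_union_le (μ := P) W Wᶜ
    rwa [union_compl_self, probReal_univ] at this
  have h2 := measureReal_mono (μ := P) hgood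
  linarith
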